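/- Let $1\le k<n$, let $X\in\mathbb R^{n\times k}$ have rank $k$, let $R\in\mathbb R^{q\times k}$ have rank $q\ge 1$, and let $r\in\mathbb R^q$. Put $\mathfrak M_0=\{X\beta:R\beta=r\}$ and let $\mathfrak M_0^{lin}$ be the linear space parallel to $\mathfrak M_0$. Let $\mathrm{span}(A)$ denote the column space of a matrix $A$, and let $P_{\mu,A}$ be the Gaussian distribution on $\mathbb R^n$ with mean $\mu$ and covariance matrix $A$. Let $\mathfrak F_{\mathrm{all}}$ be the set of all normalized spectral densities, i.e. of all nonnegative, even, integrable functions $f$ on $[-\pi,\pi]$ with $\int_{-\pi}^{\pi}f(\omega)\,d\omega=1$, and let $\Sigma(f)=\big[\int_{-\pi}^{\pi}e^{-\iota(j-l)\omega}f(\omega)\,d\omega\big]_{j,l=1}^n$ and $\mathfrak C=\{\Sigma(f):f\in\mathfrak F_{\mathrm{all}}\}$. *The test statistic.* For $y\in\mathbb R^n$ let $\hat\beta(y)=(X'X)^{-1}X'y$, $\hat u(y)=y-X\hat\beta(y)$ and $\hat v_t(y)=\hat u_t(y)x_{t\cdot}'$, where $x_{t\cdot}$ is the $t$-th row of $X$.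 Let $\hat\Gamma_j(y)=n^{-1}\sum_{t=j+1}^n\hat v_t(y)\hat v_{t-j}(y)'$ for $j\ge 0$ and $\hat\Gamma_j(y)=\hat\Gamma_{-j}(y)'$ for $j<0$, let $\hat\Psi_w(y)=\sum_{j=-(n-1)}^{n-1}w(j,n)\hat\Gamma_j(y)$ with real weights $w(j,n)$, let $\hat\Omega_w(y)=nR(X'X)^{-1}\hat\Psi_w(y)(X'X)^{-1}R'$, and let $$T_w(y)=\begin{cases}(R\hat\beta(y)-r)'\,\hat\Omega_w(y)^{-1}(R\hat\beta(y)-r)&\text{if }\det\hat\Omega_w(y)\neq0,\\0&\text{if }\det\hat\Omega_w(y)=0.\end{cases}$$ *Assumptions.* (a) The weights do not depend on $y$, $w(0,n)=1$, $w(-j,n)=w(j,n)$, and the Toeplitz matrix $(w(i-j,n))_{i,j=1}^n$ is positive definite. (b) After deleting from $X'$ all columns with an index $i$ for which the standard basis vector $e_i(n)$ lies in $\mathrm{span}(X)$, the resulting matrix $\tilde X'$ satisfies $\mathrm{rank}(R(X'X)^{-1}\tilde X')=q$. *Further notation.* Let $\mathsf B=\{y\in\mathbb R^n:\mathrm{rank}(R(X'X)^{-1}X'\,\mathrm{diag}(\hat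 u_1(y),\dots,\hat u_n(y)))<q\}$. For $\omega\in[0,\pi]$ and an integer $s\ge0$ let $E_{n,s}(\omega)$ be the $n\times2$ matrix with $j$-th row $(j^s\cos(j\omega),j^s\sin(j\omega))$, and for a linear subspace $\mathcal L\subseteq\mathbb R^n$ with $\dim\mathcal L<n$ let $\rho(\omega,\mathcal L)=\min\{s\in\{0,1,2,\dots\}:\mathrm{span}(E_{n,s}(\omega))\not\subseteq\mathcal L\}$. Write $\mathcal L=\mathfrak M_0^{lin}$, let $\Pi$ be the orthogonal projection onto $\mathcal L^\perp$, let $\mathcal L(\Sigma)=\Pi\Sigma\Pi/\|\Pi\Sigma\Pi\|$ (Frobenius norm), and let $\mathbb J$ be the set of all spaces $\mathrm{span}(\bar\Sigma)$ with $\bar\Sigma$ in the closure of $\{\mathcal L(\Sigma):\Sigma\in\mathfrak C\}$ and $\mathrm{rank}(\bar\Sigma)<n-\dim\mathcal L$. Let $C^*$ be the supremum ($-\infty$ if there is none) of all constants $C(\mathcal S)\in\mathbb R$ such that $\mathcal S\in\mathbb J$ and, for some $\mu_0\in\mathfrak M_0$, $T_w=C(\mathcal S)$ almost everywhere on $\mu_0+\mathcal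 S$ with respect to Lebesgue measure on this affine space. Finally let $$\alpha^*=\sup_{C\in(C^*,\infty)}\ \sup_{\mu_0\in\mathfrak M_0}\ \sup_{0<\sigma^2<\infty}\ \sup_{f\in\mathfrak F_{\mathrm{all}}}P_{\mu_0,\sigma^2\Sigma(f)}(T_w\ge C).$$ **Theorem.** Suppose (a) and (b) hold. 1. If $$\mathrm{span}\big(E_{n,\rho(\gamma,\mathfrak M_0^{lin})}(\gamma)\big)\not\subseteq\mathsf B\quad\text{for every }\gamma\in[0,\pi],\tag{1}$$ then for every $\alpha\in(0,1)$ there is a real number $C(\alpha)$ with $$\sup_{\mu_0\in\mathfrak M_0}\ \sup_{0<\sigma^2<\infty}\ \sup_{f\in\mathfrak F_{\mathrm{all}}}P_{\mu_0,\sigma^2\Sigma(f)}(T_w\ge C(\alpha))\le\alpha.\tag{2}$$ 2. If $\mathsf B=\mathrm{span}(X)$, then (1) holds if and only if $\mathrm{rank}\big(X,E_{n,\rho(\gamma,\mathfrak M_0^{lin})}(\gamma)\big)>k$ for every $\gamma\in[0,\pi]$. 3. If (1) holds, then for every $\alpha\in(0,\alpha^*]\cap(0,1)$ the real number $C(\alpha)$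 can be chosen such that equality holds in (2). -/

import Mathlib

namespace HAR

noncomputable section

open Matrix MeasureTheory ProbabilityTheory
open scoped ENNReal

/-! ### The linear model and the null hypothesis -/

/-- `span(A)`: the subspace of `ℝⁿ` spanned by the columns of the matrix `A`. -/
def colSpan {n : ℕ} {m : Type*} (A : Matrix (Fin n) m ℝ) :
    Submodule ℝ (EuclideanSpace ℝ (Fin n)) :=
  Submodule.span ℝ (Set.range fun j : m => WithLp.toLp 2 fun i : Fin n => A i j)

/-- The affine space `𝔐₀ = {X β : R β = r}` of means under the null hypothesis. -/
def nullMeans {n k q : ℕ} (X : Matrix (Fin n) (Fin k) ℝ) (R : Matrix (Fin q) (Fin k) ℝ)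
    (r : Fin q → ℝ) : Set (EuclideanSpace ℝ (Fin n)) :=
  {μ | ∃ β : Fin k → ℝ, μ = WithLp.toLp 2 (X *ᵥ β) ∧ R *ᵥ β = r}

/-- `𝔐₀^lin`: the linear space parallel to `𝔐₀`, i.e. the span of all differences of elements
of `𝔐₀` (which is `𝔐₀ - μ₀` for every `μ₀ ∈ 𝔐₀`, as `𝔐₀` is an affine space). -/
def nullMeansLin {n k q : ℕ} (X : Matrix (Fin n) (Fin k) ℝ) (R : Matrix (Fin q) (Fin k) ℝ)
    (r : Fin q → ℝ) : Submodule ℝ (EuclideanSpace ℝ (Fin n)) :=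
  vectorSpan ℝ (nullMeans X R r)

/-- The size of the rejection region `W` when the mean ranges over `M₀`, the scale `σ²` over
`(0, ∞)` and the covariance matrix (up to scale) over the covariance model `𝔠`:
`sup_{μ₀ ∈ M₀} sup_{0 < σ² < ∞} sup_{S ∈ 𝔠} P_{μ₀, σ² S}(W)`. -/
def size {n : ℕ} (M₀ : Set (EuclideanSpace ℝ (Fin n))) (𝔠 : Set (Matrix (Fin n) (Fin n) ℝ))
    (W : Set (EuclideanSpace ℝ (Fin n))) : ℝ≥0∞ :=
  ⨆ μ₀ ∈ M₀, ⨆ σ2 ∈ Set.Ioi (0 : ℝ), ⨆ S ∈ 𝔠, multivariateGaussian μ₀ (σ2 • S) W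

/-! ### Stationary errors -/

/-- `f` is (on `[-π, π]`) the spectral density of a real weakly stationary process, normalized
to have integral one: it is nonnegative, even, integrable and `∫_{-π}^{π} f = 1`. -/
structure IsNormalizedSpectralDensity (f : ℝ → ℝ) : Prop where
  nonneg : ∀ ω ∈ Set.Icc (-Real.pi) Real.pi, 0 ≤ f ω
  even : ∀ ω ∈ Set.Icc (-Real.pi) Real.pi, f (-ω) = f ω
  integrable : IntegrableOn f (Set.Icc (-Real.pi) Real.pi)
  integral_eq_one : ∫ ω in Set.Icc (-Real.pi) Real.pi, f ω = 1

/-- `𝔉_all`, the set of all normalized spectral densities. -/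
def Fall : Set (ℝ → ℝ) := {f | IsNormalizedSpectralDensity f}

/-- `Σ(f)`, with entries `∫_{-π}^{π} e^{-i (j - l) ω} f(ω) dω`. The integrals are real because
`f` is even, hence taking real parts only changes the type. -/
def spectralCov (n : ℕ) (f : ℝ → ℝ) : Matrix (Fin n) (Fin n) ℝ :=
  Matrix.of fun j l =>
    (∫ ω in Set.Icc (-Real.pi) Real.pi,
      Complex.exp (-Complex.I * (((j : ℂ) - (l : ℂ)) * (ω : ℂ))) * (f ω : ℂ)).re

/-- The covariance model `ℭ(𝔉) = {Σ(f) : f ∈ 𝔉}`. -/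
def covModel (n : ℕ) (𝔉 : Set (ℝ → ℝ)) : Set (Matrix (Fin n) (Fin n) ℝ) := spectralCov n '' 𝔉

/-! ### The test statistic `T_w` -/

/-- The OLS estimator `β̂(y) = (X'X)⁻¹ X' y`. -/
def olsBeta {n k : ℕ} (X : Matrix (Fin n) (Fin k) ℝ) (y : EuclideanSpace ℝ (Fin n)) :
    Fin k → ℝ :=
  (Xᵀ * X)⁻¹ *ᵥ (Xᵀ *ᵥ y.ofLp)

/-- The OLS residual vector `û(y) = y - X β̂(y)`. -/
def olsResid {n k : ℕ} (X : Matrix (Fin n) (Fin k) ℝ) (y : EuclideanSpace ℝ (Fin n)) :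
    Fin n → ℝ :=
  y.ofLp - X *ᵥ olsBeta X y

/-- `v̂_t(y) = û_t(y) x_{t·}'`. -/
def vHat {n k : ℕ} (X : Matrix (Fin n) (Fin k) ℝ) (y : EuclideanSpace ℝ (Fin n)) (t : Fin n) :
    Fin k → ℝ :=
  olsResid X y t • X t

/-- `Γ̂_j(y) = n⁻¹ ∑_{t=j+1}^{n} v̂_t(y) v̂_{t-j}(y)'` for a nonnegative lag `j`; the sum runs over
all pairs `(t, s)` of time points with `t = s + j`. -/
def gammaHatNat {n k : ℕ} (X : Matrix (Fin n) (Fin k) ℝ) (y : EuclideanSpace ℝ (Fin n)) (j : ℕ) :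
    Matrix (Fin k) (Fin k) ℝ :=
  (n : ℝ)⁻¹ • ∑ t : Fin n, ∑ s : Fin n,
    if (t : ℕ) = (s : ℕ) + j then vecMulVec (vHat X y t) (vHat X y s) else 0

/-- `Γ̂_j(y)` for an arbitrary lag, with `Γ̂_j(y) = Γ̂_{-j}(y)'` for `j < 0`. -/
def gammaHat {n k : ℕ} (X : Matrix (Fin n) (Fin k) ℝ) (y : EuclideanSpace ℝ (Fin n)) (j : ℤ) :
    Matrix (Fin k) (Fin k) ℝ :=
  if 0 ≤ j then gammaHatNat X y j.toNat else (gammaHatNat X y (-j).toNat)ᵀ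

/-- `Ψ̂_w(y) = ∑_{j=-(n-1)}^{n-1} w(j,n) Γ̂_j(y)`. The sample size `n` is fixed, so the weights are
given by the function `j ↦ w(j,n)`. -/
def psiHat {n k : ℕ} (X : Matrix (Fin n) (Fin k) ℝ) (w : ℤ → ℝ)
    (y : EuclideanSpace ℝ (Fin n)) : Matrix (Fin k) (Fin k) ℝ :=
  ∑ j ∈ Finset.Icc (-((n : ℤ) - 1)) ((n : ℤ) - 1), w j • gammaHat X y j

/-- `Ω̂_w(y) = n R (X'X)⁻¹ Ψ̂_w(y) (X'X)⁻¹ R'`. -/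
def omegaHat {n k q : ℕ} (X : Matrix (Fin n) (Fin k) ℝ) (R : Matrix (Fin q) (Fin k) ℝ)
    (w : ℤ → ℝ) (y : EuclideanSpace ℝ (Fin n)) : Matrix (Fin q) (Fin q) ℝ :=
  (n : ℝ) • (R * (Xᵀ * X)⁻¹ * psiHat X w y * (Xᵀ * X)⁻¹ * Rᵀ)

/-- The autocorrelation robust test statistic `T_w`. -/
def Tw {n k q : ℕ} (X : Matrix (Fin n) (Fin k) ℝ) (R : Matrix (Fin q) (Fin k) ℝ)
    (r : Fin q → ℝ) (w : ℤ → ℝ) (y : EuclideanSpace ℝ (Fin n)) : ℝ :=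
  if (omegaHat X R w y).det ≠ 0 then
    (R *ᵥ olsBeta X y - r) ⬝ᵥ ((omegaHat X R w y)⁻¹ *ᵥ (R *ᵥ olsBeta X y - r))
  else 0

/-- The assumption on the weights: `w(0,n) = 1`, `w(-j,n) = w(j,n)`, and the Toeplitz matrix
`(w(i-j,n))_{i,j=1}^n` is positive definite. -/
structure AssumptionAW (n : ℕ) (w : ℤ → ℝ) : Prop where
  zero : w 0 = 1
  symm : ∀ j ∈ Finset.Icc (-((n : ℤ) - 1)) ((n : ℤ) - 1), w (-j) = w j
  posDef : (Matrix.of fun i j : Fin n => w ((i : ℤ) - (j : ℤ))).PosDef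

open Classical in
/-- The assumption on `R` and `X`: after deletion from `X'` of all columns with an index `i` such
that the standard basis vector `e_i(n)` lies in `span(X)`, the matrix `R (X'X)⁻¹ X'` still has
rank `q`. -/
def AssumptionRX {n k q : ℕ} (X : Matrix (Fin n) (Fin k) ℝ) (R : Matrix (Fin q) (Fin k) ℝ) :
    Prop :=
  (R * (Xᵀ * X)⁻¹ * Xᵀ.submatrix id
    (Subtype.val : {i : Fin n // EuclideanSpace.single i (1 : ℝ) ∉ colSpan X} → Fin n)).rank = q

/-- The set `𝖡 = {y : rank (R (X'X)⁻¹ X' diag(û₁(y), …, û_n(y))) < q}`. -/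
def setB {n k q : ℕ} (X : Matrix (Fin n) (Fin k) ℝ) (R : Matrix (Fin q) (Fin k) ℝ) :
    Set (EuclideanSpace ℝ (Fin n)) :=
  {y | (R * (Xᵀ * X)⁻¹ * Xᵀ * Matrix.diagonal (olsResid X y)).rank < q}

/-! ### The matrices `E_{n,s}(ω)` and the order `ρ(ω, 𝓛)` -/

/-- `E_{n,s}(ω)`: the `n × 2` matrix with `j`-th row `(j^s cos(jω), j^s sin(jω))`, `1 ≤ j ≤ n`. -/
def Emat (n s : ℕ) (ω : ℝ) : Matrix (Fin n) (Fin 2) ℝ :=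
  Matrix.of fun j =>
    ![((j : ℝ) + 1) ^ s * Real.cos (((j : ℝ) + 1) * ω),
      ((j : ℝ) + 1) ^ s * Real.sin (((j : ℝ) + 1) * ω)]

/-- `ρ(ω, 𝓛) = min {s ∈ {0, 1, 2, …} : span(E_{n,s}(ω)) ⊄ 𝓛}` (the set is nonempty if
`dim 𝓛 < n`). -/
def rho {n : ℕ} (ω : ℝ) (L : Submodule ℝ (EuclideanSpace ℝ (Fin n))) : ℕ :=
  sInf {s : ℕ | ¬ colSpan (Emat n s ω) ≤ L}

/-! ### Concentration spaces, `C*` and `α*` -/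

/-- The Frobenius norm of a real matrix. -/
def frobNorm {n : ℕ} (A : Matrix (Fin n) (Fin n) ℝ) : ℝ := Real.sqrt (∑ i, ∑ j, A i j ^ 2)

/-- The matrix of the orthogonal projection onto the orthogonal complement of `𝓛`. -/
def projPerp {n : ℕ} (L : Submodule ℝ (EuclideanSpace ℝ (Fin n))) : Matrix (Fin n) (Fin n) ℝ :=
  (Matrix.toEuclideanCLM (n := Fin n) (𝕜 := ℝ)).symm Lᗮ.starProjection

/-- `𝓛(S) = Π S Π / ‖Π S Π‖` with `Π` the orthogonal projection onto the orthogonal complement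
of `𝓛`. -/
def normProj {n : ℕ} (L : Submodule ℝ (EuclideanSpace ℝ (Fin n)))
    (S : Matrix (Fin n) (Fin n) ℝ) : Matrix (Fin n) (Fin n) ℝ :=
  (frobNorm (projPerp L * S * projPerp L))⁻¹ • (projPerp L * S * projPerp L)

/-- `𝕁(𝓛, ℭ) = {span(S̄) : S̄ ∈ cl(𝓛(ℭ)), rank(S̄) < n - dim(𝓛)}`. -/
def concSpaces {n : ℕ} (L : Submodule ℝ (EuclideanSpace ℝ (Fin n)))
    (𝔠 : Set (Matrix (Fin n) (Fin n) ℝ)) : Set (Submodule ℝ (EuclideanSpace ℝ (Fin n))) :=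
  {V | ∃ S ∈ closure (normProj L '' 𝔠), S.rank + Module.finrank ℝ L < n ∧ V = colSpan S}

/-- Lebesgue measure on the affine space `μ + V`, viewed as a measure on `ℝⁿ`: the image of
Lebesgue measure on `ℝ^(dim V)` under `x ↦ μ + ∑ x_i b_i`, for an orthonormal basis `(b_i)`
of `V`. -/
def affineLebesgue {n : ℕ} (μ : EuclideanSpace ℝ (Fin n))
    (V : Submodule ℝ (EuclideanSpace ℝ (Fin n))) : Measure (EuclideanSpace ℝ (Fin n)) :=
  (volume : Measure (EuclideanSpace ℝ (Fin (Module.finrank ℝ V)))).map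
    fun x => μ + ((stdOrthonormalBasis ℝ V).repr.symm x : EuclideanSpace ℝ (Fin n))

/-- `C* = sup {C(V) : V ∈ ℍ}`, where `ℍ` consists of all `V ∈ 𝕁(𝓛, ℭ)` such that, for some
`μ₀ ∈ M₀`, the statistic `T` restricted to `μ₀ + V` equals a constant `C(V)` almost everywhere
with respect to Lebesgue measure on `μ₀ + V`; `C* = -∞` if `ℍ` is empty. -/
def Cstar {n : ℕ} (M₀ : Set (EuclideanSpace ℝ (Fin n)))
    (L : Submodule ℝ (EuclideanSpace ℝ (Fin n))) (𝔠 : Set (Matrix (Fin n) (Fin n) ℝ))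
    (T : EuclideanSpace ℝ (Fin n) → ℝ) : EReal :=
  sSup {c : EReal | ∃ V ∈ concSpaces L 𝔠, ∃ μ₀ ∈ M₀, ∃ c' : ℝ,
    (∀ᵐ y ∂(affineLebesgue μ₀ V), T y = c') ∧ c = (c' : EReal)}

/-- `α* = sup_{C ∈ (C*, ∞)} sup_{μ₀} sup_{σ²} sup_{S ∈ ℭ} P_{μ₀, σ² S}(T ≥ C)`. -/
def alphaStar {n : ℕ} (M₀ : Set (EuclideanSpace ℝ (Fin n)))
    (L : Submodule ℝ (EuclideanSpace ℝ (Fin n))) (𝔠 : Set (Matrix (Fin n) (Fin n) ℝ))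
    (T : EuclideanSpace ℝ (Fin n) → ℝ) : ℝ≥0∞ :=
  ⨆ C ∈ {C : ℝ | Cstar M₀ L 𝔠 T < (C : EReal)}, size M₀ 𝔠 {y | C ≤ T y}

/-- The non-inclusion condition: `span(E_{n,ρ(γ,𝔐₀^lin)}(γ)) ⊄ 𝖡` for every `γ ∈ [0, π]`. -/
def NonIncl {n k q : ℕ} (X : Matrix (Fin n) (Fin k) ℝ) (R : Matrix (Fin q) (Fin k) ℝ)
    (r : Fin q → ℝ) : Prop :=
  ∀ γ ∈ Set.Icc (0 : ℝ) Real.pi,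
    ¬ ((colSpan (Emat n (rho γ (nullMeansLin X R r)) γ) : Set (EuclideanSpace ℝ (Fin n))) ⊆
      setB X R)

end

end HAR

namespace HAR

open Matrix MeasureTheory ProbabilityTheory Filter Topology
open scoped ENNReal Asymptotics MatrixOrder

/-! ### Null sets of real analytic functions -/

/-! Write `Π` for the orthogonal projection onto the complement of `L = 𝔐₀^lin`, and e(ω) for the
vector with entries e^{ijω}. The residuals ignore shifts by span(X), and the statistic for the
homogeneous hypothesis is moreover invariant under shifts by `L` and under rescaling. Hence a null
rejection probability depends only on the factor A = ‖ΠΣΠ‖^{-1/2} ΠΣ^{1/2}: it is the probability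
that T(Az) ≥ C for standard Gaussian z. These factors form a bounded set, so size control is a
compactness question about their closure, where degenerate limits appear.

The central step (`exists_frequency_of_mem_closure`) is that every limit S = AA' has a column space
containing Π span(E_{n,ρ(γ)}(γ)) for some γ. Otherwise, with Q the projection off span(S), QΠe(ω)
vanishes at every γ to the same order as Πe(ω). Compactness then gives ‖Πe(ω)‖² ≤ c‖QΠe(ω)‖², and
integration against f and passage to the limit give tr S ≤ c tr(QSQ) = 0, contradicting ‖S‖ = 1.

Condition (1) therefore makes det Ω̂ not identically zero on the range of any limit A. It is
analytic, so it is nonzero almost surely; T is then almost surely finite and continuous at Az, and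
the rejection probability tends to 0 uniformly over the compact closure as C → ∞.

For exact size, T = num/den with num and den analytic. If C > C*, num - C den is not identically
zero on the range of a limit A, so {T(Az) = C} is null and the size is continuous on (C*, ∞). The
intermediate value theorem handles α < α*; the endpoint α = α* is attained at C* itself. -/

theorem countable_zeros_of_analytic {E : Type*} [NormedAddCommGroup E] [NormedSpace ℝ E]
    {f : ℝ → E} (hf : AnalyticOnNhd ℝ f Set.univ) {x : ℝ}
    (hx : f x ≠ 0) : {t | f t = 0}.Countable := by
  have h := hf.preimage_zero_mem_codiscrete hx
  rw [mem_codiscrete'] at h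
  have h2 : (f ⁻¹' {0}ᶜ)ᶜ = {t | f t = 0} := by ext t; simp
  rw [h2] at h
  have : DiscreteTopology {t | f t = 0} := isDiscrete_iff_discreteTopology.1 h.2
  exact Set.countable_coe_iff.1 (TopologicalSpace.separableSpace_iff_countable.1 inferInstance)

/-- Induction on the dimension with Fubini. With the remaining coordinates frozen at those of `x₀`,
only countably many first coordinates give zero; for every other one the slice is analytic and
nonzero somewhere, so the induction hypothesis applies to it. -/
theorem pi_ae_ne_zero_of_analytic : ∀ {n : ℕ} (ν : Fin n → Measure ℝ) [∀ i, SigmaFinite (ν i)]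
    [∀ i, NullSingletonClass (ν i)] {f : (Fin n → ℝ) → ℝ}, AnalyticOnNhd ℝ f Set.univ →
    ∀ {x₀ : Fin n → ℝ}, f x₀ ≠ 0 → ∀ᵐ x ∂(Measure.pi ν), f x ≠ 0 := by
  intro n
  induction n with
  | zero =>
    intro ν _ _ f _ x₀ hx₀
    refine Eventually.of_forall fun x => ?_
    rwa [Subsingleton.elim x x₀]
  | succ n ih =>
    intro ν _ _ f hf x₀ hx₀
    have hc : Continuous f := continuousOn_univ.1 hf.continuousOn
    have hmp := (measurePreserving_piFinSuccAbove ν 0).symm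
    have hs : MeasurableSet {x | f x = 0} := hc.measurable (measurableSet_singleton 0)
    simp only [ae_iff, not_not]
    rw [← hmp.map_eq, Measure.map_apply hmp.measurable hs,
      Measure.measure_prod_null (hmp.measurable hs)]
    have hins : ∀ (t : ℝ) (y : Fin n → ℝ),
        (MeasurableEquiv.piFinSuccAbove (fun _ : Fin (n + 1) => ℝ) 0).symm (t, y) =
          (Fin.cons t y : Fin (n + 1) → ℝ) := by
      intro t y
      simp [MeasurableEquiv.piFinSuccAbove, Fin.insertNthEquiv]
    have hleft : ∀ y : Fin n → ℝ, AnalyticOnNhd ℝ (fun t : ℝ => f (Fin.cons t y)) Set.univ := by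
      intro y
      refine hf.comp (fun t _ => ?_) (fun _ _ => Set.mem_univ _)
      refine AnalyticAt.pi fun i => ?_
      refine Fin.cases ?_ (fun j => ?_) i
      · simpa using! (analyticAt_id : AnalyticAt ℝ id t)
      · simpa using analyticAt_const
    have hright : ∀ t : ℝ, AnalyticOnNhd ℝ (fun y : Fin n → ℝ => f (Fin.cons t y)) Set.univ := by
      intro t
      refine hf.comp (fun y _ => ?_) (fun _ _ => Set.mem_univ _)
      refine AnalyticAt.pi fun i => ?_
      refine Fin.cases ?_ (fun j => ?_) i
      · simpa using analyticAt_const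
      · simpa using! (ContinuousLinearMap.proj (R := ℝ) (φ := fun _ : Fin n => ℝ) j).analyticAt y
    have hcount : {t | f (Fin.cons t (Fin.tail x₀)) = 0}.Countable :=
      countable_zeros_of_analytic (hleft _) (x := x₀ 0) (by simpa using hx₀)
    filter_upwards [hcount.ae_notMem (ν 0)] with t ht
    have h := ih (fun j => ν (Fin.succAbove 0 j)) (hright t) (x₀ := Fin.tail x₀) ht
    simp only [ae_iff, not_not] at h
    simpa only [Set.preimage, Set.mem_ofPred_eq, hins] using! h

theorem analyticAt_toLp {n : ℕ} (x : Fin n → ℝ) :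
    AnalyticAt ℝ (fun x : Fin n → ℝ => (WithLp.toLp 2 x : EuclideanSpace ℝ (Fin n))) x :=
  ((EuclideanSpace.equiv (Fin n) ℝ).symm : (Fin n → ℝ) →L[ℝ] EuclideanSpace ℝ (Fin n)).analyticAt x

theorem stdGaussian_ae_ne_zero_of_analytic {n : ℕ} {f : EuclideanSpace ℝ (Fin n) → ℝ}
    (hf : AnalyticOnNhd ℝ f Set.univ) {x₀ : EuclideanSpace ℝ (Fin n)} (hx₀ : f x₀ ≠ 0) :
    ∀ᵐ x ∂(stdGaussian (EuclideanSpace ℝ (Fin n))), f x ≠ 0 := by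
  have hc : Continuous f := continuousOn_univ.1 hf.continuousOn
  have hs : MeasurableSet {x | f x ≠ 0} := (hc.measurable (measurableSet_singleton 0)).compl
  have hna : NullSingletonClass (gaussianReal 0 1) := nullSingletonClass_gaussianReal one_ne_zero
  rw [← map_pi_eq_stdGaussian, ae_map_iff (by fun_prop) hs]
  exact pi_ae_ne_zero_of_analytic _ (f := fun x => f (WithLp.toLp 2 x))
    (hf.comp (fun x _ => analyticAt_toLp x) (fun _ _ => Set.mem_univ _)) (x₀ := x₀.ofLp) hx₀

theorem volume_ae_ne_zero_of_analytic {n : ℕ} {f : EuclideanSpace ℝ (Fin n) → ℝ}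
    (hf : AnalyticOnNhd ℝ f Set.univ) {x₀ : EuclideanSpace ℝ (Fin n)} (hx₀ : f x₀ ≠ 0) :
    ∀ᵐ x, f x ≠ 0 := by
  have hc : Continuous f := continuousOn_univ.1 hf.continuousOn
  have hs : MeasurableSet {x | f x ≠ 0} := (hc.measurable (measurableSet_singleton 0)).compl
  rw [← (PiLp.volume_preserving_toLp (Fin n)).map_eq,
    ae_map_iff (by fun_prop) hs]
  exact pi_ae_ne_zero_of_analytic _ (f := fun x => f (WithLp.toLp 2 x))
    (hf.comp (fun x _ => analyticAt_toLp x) (fun _ _ => Set.mem_univ _)) (x₀ := x₀.ofLp) hx₀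

/-! ### Algebra of the test statistic -/

section Algebra

variable {n k q : ℕ} {X : Matrix (Fin n) (Fin k) ℝ} {R : Matrix (Fin q) (Fin k) ℝ}

theorem isUnit_det_gram (hX : X.rank = k) : IsUnit (Xᵀ * X).det := by
  have h : LinearIndependent ℝ (Xᵀ * X).row := by
    rw [linearIndependent_iff_card_eq_finrank_span, Set.finrank, ← rank_eq_finrank_span_row,
      rank_transpose_mul_self, hX, Fintype.card_fin]
  exact (Matrix.isUnit_iff_isUnit_det _).1 (linearIndependent_rows_iff_isUnit.1 h)

theorem olsBeta_add (y z : EuclideanSpace ℝ (Fin n)) :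
    olsBeta X (y + z) = olsBeta X y + olsBeta X z := by
  simp [olsBeta, mulVec_add]

theorem olsBeta_smul (c : ℝ) (y : EuclideanSpace ℝ (Fin n)) :
    olsBeta X (c • y) = c • olsBeta X y := by
  simp [olsBeta, mulVec_smul]

theorem olsBeta_mulVec (hX : X.rank = k) (b : Fin k → ℝ) :
    olsBeta X (WithLp.toLp 2 (X *ᵥ b)) = b := by
  simp only [olsBeta, mulVec_mulVec]
  rw [nonsing_inv_mul _ (isUnit_det_gram hX), one_mulVec]

theorem olsResid_add_mulVec (hX : X.rank = k) (y : EuclideanSpace ℝ (Fin n)) (b : Fin k → ℝ) :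
    olsResid X (y + WithLp.toLp 2 (X *ᵥ b)) = olsResid X y := by
  simp [olsResid, olsBeta_add, olsBeta_mulVec hX, mulVec_add]

theorem olsResid_smul (c : ℝ) (y : EuclideanSpace ℝ (Fin n)) :
    olsResid X (c • y) = c • olsResid X y := by
  simp [olsResid, olsBeta_smul, mulVec_smul, smul_sub]

theorem gammaHat_eq (y : EuclideanSpace ℝ (Fin n)) (j : ℤ) :
    gammaHat X y j = (n : ℝ)⁻¹ • ∑ t : Fin n, ∑ s : Fin n,
      if (t : ℤ) - (s : ℤ) = j then vecMulVec (vHat X y t) (vHat X y s) else 0 := by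
  unfold gammaHat gammaHatNat
  split_ifs with hj
  · congr 1
    refine Finset.sum_congr rfl fun t _ => Finset.sum_congr rfl fun s _ => ?_
    exact if_congr (by omega) rfl rfl
  · rw [transpose_smul, transpose_sum, Finset.sum_comm]
    congr 1
    refine Finset.sum_congr rfl fun t _ => ?_
    rw [transpose_sum]
    refine Finset.sum_congr rfl fun s _ => ?_
    by_cases h : (s : ℤ) - (t : ℤ) = j
    · rw [if_pos h, if_pos (by omega), transpose_vecMulVec]
    · rw [if_neg h, if_neg (by omega), transpose_zero]

theorem mul_mul_transpose_apply {l m : Type*} [Fintype m] (N : Matrix l m ℝ) (W : Matrix m m ℝ)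
    (i j : l) : (N * W * Nᵀ) i j = ∑ t, ∑ s, N i t * W t s * N j s := by
  simp only [Matrix.mul_apply, transpose_apply, Finset.sum_mul]
  exact Finset.sum_comm

/-- The matrix `R (X'X)⁻¹ X'`. -/
noncomputable def restrictionHat (X : Matrix (Fin n) (Fin k) ℝ) (R : Matrix (Fin q) (Fin k) ℝ) :
    Matrix (Fin q) (Fin n) ℝ :=
  R * (Xᵀ * X)⁻¹ * Xᵀ

/-- The Toeplitz matrix of the weights. -/
def weightToeplitz (n : ℕ) (w : ℤ → ℝ) : Matrix (Fin n) (Fin n) ℝ :=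
  Matrix.of fun i j : Fin n => w ((i : ℤ) - (j : ℤ))

/-- Grouping the pairs (t, s) by their lag t - s, which always lies in the range of summation, turns
the weighted autocovariances into one quadratic form in the Toeplitz matrix of the weights. -/
theorem psiHat_eq (w : ℤ → ℝ) (y : EuclideanSpace ℝ (Fin n)) :
    psiHat X w y = (n : ℝ)⁻¹ • (Xᵀ * diagonal (olsResid X y) * weightToeplitz n w *
      (Xᵀ * diagonal (olsResid X y))ᵀ) := by
  have h : psiHat X w y = (n : ℝ)⁻¹ • ∑ t : Fin n, ∑ s : Fin n,
      w ((t : ℤ) - (s : ℤ)) • vecMulVec (vHat X y t) (vHat X y s) := by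
    unfold psiHat
    simp_rw [gammaHat_eq, smul_comm (w _) ((n : ℝ)⁻¹), ← Finset.smul_sum]
    congr 1
    simp_rw [Finset.smul_sum]
    rw [Finset.sum_comm]
    refine Finset.sum_congr rfl fun t _ => ?_
    rw [Finset.sum_comm]
    refine Finset.sum_congr rfl fun s _ => ?_
    simp only [smul_ite, smul_zero]
    rw [Finset.sum_ite_eq, if_pos]
    rw [Finset.mem_Icc]
    omega
  rw [h]
  congr 1
  ext a b
  simp only [Matrix.sum_apply, Matrix.smul_apply, vecMulVec_apply, vHat, Pi.smul_apply,
    smul_eq_mul, mul_mul_transpose_apply, transpose_apply, mul_diagonal, weightToeplitz, of_apply]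
  refine Finset.sum_congr rfl fun t _ => Finset.sum_congr rfl fun s _ => ?_
  ring

theorem omegaHat_eq (hn : 0 < n) (w : ℤ → ℝ) (y : EuclideanSpace ℝ (Fin n)) :
    omegaHat X R w y = (restrictionHat X R * diagonal (olsResid X y)) * weightToeplitz n w *
      (restrictionHat X R * diagonal (olsResid X y))ᵀ := by
  have hn' : (n : ℝ) ≠ 0 := by positivity
  unfold omegaHat restrictionHat
  rw [psiHat_eq]
  simp only [Matrix.mul_smul, Matrix.smul_mul, smul_smul, mul_inv_cancel₀ hn', one_smul,
    transpose_mul, transpose_transpose, transpose_nonsing_inv, Matrix.mul_assoc]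

theorem rank_eq_iff_vecMul_injective {m : ℕ} (N : Matrix (Fin q) (Fin m) ℝ) :
    N.rank = q ↔ Function.Injective fun v => v ᵥ* N := by
  rw [vecMul_injective_iff, linearIndependent_iff_card_eq_finrank_span, Set.finrank,
    ← rank_eq_finrank_span_row, Fintype.card_fin, eq_comm]

theorem omegaHat_posSemidef (hn : 0 < n) {w : ℤ → ℝ} (hw : AssumptionAW n w)
    (y : EuclideanSpace ℝ (Fin n)) : (omegaHat X R w y).PosSemidef := by
  rw [omegaHat_eq hn, ← conjTranspose_eq_transpose_of_trivial]
  exact hw.posDef.posSemidef.mul_mul_conjTranspose_same _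

/-- Ω̂ = N W N' with W positive definite, so Ω̂ is nonsingular exactly when N = R(X'X)⁻¹X' diag(û)
has full row rank. -/
theorem det_omegaHat_ne_zero_iff (hn : 0 < n) {w : ℤ → ℝ} (hw : AssumptionAW n w)
    (y : EuclideanSpace ℝ (Fin n)) : (omegaHat X R w y).det ≠ 0 ↔ y ∉ setB X R := by
  have hB : y ∉ setB X R ↔ (restrictionHat X R * diagonal (olsResid X y)).rank = q := by
    have := rank_le_height (restrictionHat X R * diagonal (olsResid X y))
    change ¬ (restrictionHat X R * diagonal (olsResid X y)).rank < q ↔ _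
    omega
  rw [hB]
  constructor
  · intro h
    have h1 := rank_of_det_ne_zero h
    rw [omegaHat_eq hn, Fintype.card_fin, Matrix.mul_assoc] at h1
    have h2 := rank_mul_le_left (restrictionHat X R * diagonal (olsResid X y))
      (weightToeplitz n w * (restrictionHat X R * diagonal (olsResid X y))ᵀ)
    have h3 := rank_le_height (restrictionHat X R * diagonal (olsResid X y))
    omega
  · intro h
    rw [omegaHat_eq hn, ← conjTranspose_eq_transpose_of_trivial]
    exact (hw.posDef.mul_mul_conjTranspose_same
      ((rank_eq_iff_vecMul_injective _).1 h)).det_pos.ne'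

theorem omegaHat_congr {w : ℤ → ℝ} (hn : 0 < n) {y z : EuclideanSpace ℝ (Fin n)}
    (h : olsResid X y = olsResid X z) : omegaHat X R w y = omegaHat X R w z := by
  rw [omegaHat_eq hn, omegaHat_eq hn, h]

theorem omegaHat_add_mulVec (hn : 0 < n) (hX : X.rank = k) (w : ℤ → ℝ)
    (y : EuclideanSpace ℝ (Fin n)) (b : Fin k → ℝ) :
    omegaHat X R w (y + WithLp.toLp 2 (X *ᵥ b)) = omegaHat X R w y :=
  omegaHat_congr hn (olsResid_add_mulVec hX y b)

theorem omegaHat_smul (hn : 0 < n) (w : ℤ → ℝ) (c : ℝ) (y : EuclideanSpace ℝ (Fin n)) :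
    omegaHat X R w (c • y) = c ^ 2 • omegaHat X R w y := by
  rw [omegaHat_eq hn, omegaHat_eq hn, olsResid_smul, diagonal_smul]
  simp only [Matrix.mul_smul, Matrix.smul_mul, transpose_smul, smul_smul, pow_two]

/-- The numerator of the test statistic of a homogeneous hypothesis. -/
noncomputable def statNum (X : Matrix (Fin n) (Fin k) ℝ) (R : Matrix (Fin q) (Fin k) ℝ)
    (w : ℤ → ℝ) (y : EuclideanSpace ℝ (Fin n)) : ℝ :=
  (R *ᵥ olsBeta X y) ⬝ᵥ ((omegaHat X R w y).adjugate *ᵥ (R *ᵥ olsBeta X y))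

/-- The denominator of the test statistic. -/
noncomputable def statDen (X : Matrix (Fin n) (Fin k) ℝ) (R : Matrix (Fin q) (Fin k) ℝ)
    (w : ℤ → ℝ) (y : EuclideanSpace ℝ (Fin n)) : ℝ :=
  (omegaHat X R w y).det

/-- The adjugate keeps the numerator analytic even where Ω̂ is singular, and the convention x / 0 =
0 matches the value 0 assigned to the statistic there. -/
theorem Tw_eq_div (w : ℤ → ℝ) (y : EuclideanSpace ℝ (Fin n)) :
    Tw X R 0 w y = statNum X R w y / statDen X R w y := by
  unfold Tw statNum statDen
  split_ifs with h
  · rw [inv_def, smul_mulVec, dotProduct_smul, sub_zero, Ring.inverse_eq_inv', smul_eq_mul,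
      div_eq_inv_mul]
  · rw [not_not.1 h, div_zero]

theorem Tw_add_mulVec (hn : 0 < n) (hX : X.rank = k) (w : ℤ → ℝ) {r s : Fin q → ℝ}
    {b : Fin k → ℝ} (hb : R *ᵥ b = s) (y : EuclideanSpace ℝ (Fin n)) :
    Tw X R (r + s) w (y + WithLp.toLp 2 (X *ᵥ b)) = Tw X R r w y := by
  unfold Tw
  rw [omegaHat_add_mulVec hn hX, olsBeta_add, olsBeta_mulVec hX, mulVec_add, hb,
    add_sub_add_right_eq_sub]

theorem Tw_smul (hn : 0 < n) (w : ℤ → ℝ) {c : ℝ} (hc : c ≠ 0) (y : EuclideanSpace ℝ (Fin n)) :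
    Tw X R 0 w (c • y) = Tw X R 0 w y := by
  unfold Tw
  rw [omegaHat_smul hn, olsBeta_smul]
  by_cases h : (omegaHat X R w y).det = 0
  · have h2 : (c ^ 2 • omegaHat X R w y).det = 0 := by rw [det_smul, h, mul_zero]
    rw [if_neg (not_not.2 h2), if_neg (not_not.2 h)]
  · have h2 : (c ^ 2 • omegaHat X R w y).det ≠ 0 := by
      rw [det_smul]; exact mul_ne_zero (by positivity) h
    have h3 : (c ^ 2 • omegaHat X R w y)⁻¹ = (c ^ 2)⁻¹ • (omegaHat X R w y)⁻¹ := by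
      refine inv_eq_left_inv ?_
      rw [Matrix.smul_mul, Matrix.mul_smul, smul_smul, inv_mul_cancel₀ (pow_ne_zero 2 hc),
        one_smul, nonsing_inv_mul _ (Ne.isUnit h)]
    rw [if_pos h2, if_pos h, h3]
    simp only [sub_zero, mulVec_smul, smul_mulVec, dotProduct_smul, smul_dotProduct, smul_eq_mul]
    field_simp

theorem Tw_nonneg (hn : 0 < n) {w : ℤ → ℝ} (hw : AssumptionAW n w) (r : Fin q → ℝ)
    (y : EuclideanSpace ℝ (Fin n)) : 0 ≤ Tw X R r w y := by
  unfold Tw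
  split_ifs with h
  · simpa using (omegaHat_posSemidef hn hw y).inv.dotProduct_mulVec_nonneg
      (R *ᵥ olsBeta X y - r)
  · exact le_rfl

theorem analyticAt_olsBeta (j : Fin k) (y : EuclideanSpace ℝ (Fin n)) :
    AnalyticAt ℝ (fun y => olsBeta X y j) y := by
  have h : ∀ i : Fin n, AnalyticAt ℝ (fun y : EuclideanSpace ℝ (Fin n) => y.ofLp i) y :=
    fun i => (EuclideanSpace.proj (𝕜 := ℝ) i).analyticAt y
  simp only [olsBeta, mulVec, dotProduct]
  fun_prop

theorem analyticAt_omegaHat (hn : 0 < n) (w : ℤ → ℝ) (i j : Fin q)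
    (y : EuclideanSpace ℝ (Fin n)) : AnalyticAt ℝ (fun y => omegaHat X R w y i j) y := by
  have h : ∀ i : Fin n, AnalyticAt ℝ (fun y : EuclideanSpace ℝ (Fin n) => y.ofLp i) y :=
    fun i => (EuclideanSpace.proj (𝕜 := ℝ) i).analyticAt y
  have hβ := fun j => analyticAt_olsBeta (X := X) j y
  simp only [omegaHat_eq hn, mul_mul_transpose_apply, mul_diagonal, olsResid, Pi.sub_apply,
    mulVec, dotProduct]
  fun_prop

theorem analyticAt_det {E : Type*} [NormedAddCommGroup E] [NormedSpace ℝ E]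
    {M : E → Matrix (Fin q) (Fin q) ℝ} {y : E}
    (hM : ∀ i j, AnalyticAt ℝ (fun y => M y i j) y) : AnalyticAt ℝ (fun y => (M y).det) y := by
  simp only [det_apply']
  fun_prop

theorem analyticAt_adjugate {E : Type*} [NormedAddCommGroup E] [NormedSpace ℝ E]
    {M : E → Matrix (Fin q) (Fin q) ℝ} {y : E}
    (hM : ∀ i j, AnalyticAt ℝ (fun y => M y i j) y) (i j : Fin q) :
    AnalyticAt ℝ (fun y => (M y).adjugate i j) y := by
  simp only [adjugate_apply]
  refine analyticAt_det fun a b => ?_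
  by_cases hab : a = j
  · subst hab
    simpa only [updateRow_self] using analyticAt_const
  · simpa only [updateRow_ne hab] using hM a b

theorem statDen_analytic (hn : 0 < n) (w : ℤ → ℝ) :
    AnalyticOnNhd ℝ (statDen X R w) Set.univ :=
  fun y _ => analyticAt_det fun i j => analyticAt_omegaHat hn w i j y

theorem statNum_analytic (hn : 0 < n) (w : ℤ → ℝ) :
    AnalyticOnNhd ℝ (statNum X R w) Set.univ := by
  intro y _
  have h1 := fun j => analyticAt_olsBeta (X := X) j y
  have h2 := analyticAt_adjugate (fun i j => analyticAt_omegaHat (X := X) (R := R) hn w i j y)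
  unfold statNum
  simp only [mulVec, dotProduct]
  fun_prop

theorem mulVec_surjective (hR : R.rank = q) : Function.Surjective R.mulVec := by
  have h := rank_eq_finrank_range_toLin R (Pi.basisFun ℝ (Fin q)) (Pi.basisFun ℝ (Fin k))
  rw [toLin_eq_toLin', hR] at h
  have h2 : LinearMap.range (toLin' R) = ⊤ :=
    Submodule.eq_top_of_finrank_eq (by rw [← h, Module.finrank_fin_fun])
  intro v
  obtain ⟨b, hb⟩ := LinearMap.range_eq_top.1 h2 v
  exact ⟨b, hb⟩

/-- Adding an element of span(X) leaves Ω̂ fixed while `R β̂` can be moved to any prescribed vector,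
because R is onto. A unit vector makes the numerator nonzero when C = 0; the zero vector leaves only
-C det Ω̂ otherwise. -/
theorem exists_statNum_sub_ne_zero (hn : 0 < n) (hq : 1 ≤ q) (hX : X.rank = k) (hR : R.rank = q)
    {w : ℤ → ℝ} (hw : AssumptionAW n w) {y : EuclideanSpace ℝ (Fin n)}
    (hy : statDen X R w y ≠ 0) (C : ℝ) :
    ∃ z, statNum X R w z - C * statDen X R w z ≠ 0 := by
  have hsurj := mulVec_surjective hR
  have hpd : (omegaHat X R w y).PosDef := (omegaHat_posSemidef hn hw y).posDef_iff_det_ne_zero.2 hy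
  have key : ∀ v : Fin q → ℝ, ∃ z, omegaHat X R w z = omegaHat X R w y ∧ R *ᵥ olsBeta X z = v := by
    intro v
    obtain ⟨b, hb⟩ := hsurj (v - R *ᵥ olsBeta X y)
    refine ⟨y + WithLp.toLp 2 (X *ᵥ b), omegaHat_add_mulVec hn hX w y b, ?_⟩
    rw [olsBeta_add, olsBeta_mulVec hX, mulVec_add, hb, add_sub_cancel]
  by_cases hC : C = 0
  · obtain ⟨z, hz1, hz2⟩ := key (Pi.single ⟨0, hq⟩ 1)
    refine ⟨z, ?_⟩
    have hne : (Pi.single ⟨0, hq⟩ 1 : Fin q → ℝ) ≠ 0 := by simp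
    have h := hpd.inv.dotProduct_mulVec_pos hne
    rw [inv_def, smul_mulVec, dotProduct_smul, Ring.inverse_eq_inv', star_trivial] at h
    rw [hC, zero_mul, sub_zero, statNum, hz1, hz2]
    intro h0
    rw [h0, smul_zero] at h
    exact h.ne rfl
  · obtain ⟨z, hz1, hz2⟩ := key 0
    refine ⟨z, ?_⟩
    rw [statNum, statDen, hz1, hz2, zero_dotProduct, zero_sub]
    exact neg_ne_zero.2 (mul_ne_zero hC hy)

/-- This inclusion is all that is needed of `𝔐₀^lin`: shifts by its elements change neither the
residuals nor `R β̂`. -/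
theorem nullMeansLin_subset {r : Fin q → ℝ} {l : EuclideanSpace ℝ (Fin n)}
    (hl : l ∈ nullMeansLin X R r) : ∃ b, l = WithLp.toLp 2 (X *ᵥ b) ∧ R *ᵥ b = 0 := by
  unfold nullMeansLin vectorSpan at hl
  induction hl using Submodule.span_induction with
  | mem x hx =>
    obtain ⟨_, ⟨b, rfl, hb⟩, _, ⟨c, rfl, hc⟩, rfl⟩ := hx
    exact ⟨b - c, by simp [mulVec_sub], by simp [mulVec_sub, hb, hc]⟩
  | zero => exact ⟨0, by simp, by simp⟩
  | add x y _ _ hx hy =>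
    obtain ⟨b, rfl, hb⟩ := hx
    obtain ⟨c, rfl, hc⟩ := hy
    exact ⟨b + c, by simp [mulVec_add], by simp [mulVec_add, hb, hc]⟩
  | smul a x _ hx =>
    obtain ⟨b, rfl, hb⟩ := hx
    exact ⟨a • b, by simp [mulVec_smul], by simp [mulVec_smul, hb]⟩


end Algebra

/-! ### Oscillating vectors -/

theorem taylor_leading_term {F : Type*} [NormedAddCommGroup F] [NormedSpace ℝ F] {g : ℝ → F}
    {γ : ℝ} {s : ℕ} (hg : ContDiff ℝ s g) (h0 : ∀ i < s, iteratedDeriv i g γ = 0) :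
    (fun ω => g ω - (ω - γ) ^ s • ((s.factorial : ℝ)⁻¹ • iteratedDeriv s g γ)) =o[𝓝 γ]
      fun ω => (ω - γ) ^ s := by
  refine (taylor_isLittleO_univ hg).congr_left fun ω => ?_
  rw [taylor_within_apply, Finset.sum_range_succ, Finset.sum_eq_zero, zero_add,
    iteratedDerivWithin_univ, mul_comm, mul_smul]
  intro i hi
  rw [iteratedDerivWithin_univ, h0 i (Finset.mem_range.1 hi), smul_zero]

/-- `g` vanishes at γ to order at least s and `h` to order exactly s, so both are compared with (ω -
γ)^s. -/
theorem isBigO_of_leading_terms {F G : Type*} [NormedAddCommGroup F] [NormedSpace ℝ F]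
    [NormedAddCommGroup G] [NormedSpace ℝ G] {g : ℝ → F} {h : ℝ → G} {γ : ℝ} {s : ℕ}
    (hg : ContDiff ℝ s g) (hh : ContDiff ℝ s h) (hg0 : ∀ i < s, iteratedDeriv i g γ = 0)
    (hh0 : ∀ i < s, iteratedDeriv i h γ = 0) (hne : iteratedDeriv s h γ ≠ 0) :
    g =O[𝓝 γ] h := by
  have hfact : (s.factorial : ℝ)⁻¹ ≠ 0 := inv_ne_zero (Nat.cast_ne_zero.2 s.factorial_ne_zero)
  have h1 : g =O[𝓝 γ] fun ω => (ω - γ) ^ s := by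
    have h2 : (fun ω : ℝ => (ω - γ) ^ s • ((s.factorial : ℝ)⁻¹ • iteratedDeriv s g γ)) =O[𝓝 γ]
        fun ω => (ω - γ) ^ s := by
      refine Asymptotics.IsBigO.of_bound ‖(s.factorial : ℝ)⁻¹ • iteratedDeriv s g γ‖
        (Eventually.of_forall fun ω => ?_)
      rw [norm_smul, mul_comm]
    exact ((taylor_leading_term hg hg0).isBigO.add h2).congr_left fun ω => sub_add_cancel _ _
  refine h1.trans ?_
  have hb : (s.factorial : ℝ)⁻¹ • iteratedDeriv s h γ ≠ 0 := smul_ne_zero hfact hne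
  have h3 : (fun ω : ℝ => (ω - γ) ^ s) =O[𝓝 γ]
      fun ω : ℝ => (ω - γ) ^ s • ((s.factorial : ℝ)⁻¹ • iteratedDeriv s h γ) := by
    refine Asymptotics.IsBigO.of_bound ‖(s.factorial : ℝ)⁻¹ • iteratedDeriv s h γ‖⁻¹
      (Eventually.of_forall fun ω => ?_)
    rw [norm_smul _ ((s.factorial : ℝ)⁻¹ • _), mul_comm, mul_assoc,
      mul_inv_cancel₀ (norm_ne_zero_iff.2 hb), mul_one]
  refine h3.trans ?_
  -- The remainder of `h` is negligible against its nonzero leading term, so that leading term is in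
  -- turn bounded by a multiple of `h`.
  have h4 := ((taylor_leading_term hh hh0).trans_isBigO h3).right_isBigO_add
  exact h4.congr_right fun ω => sub_add_cancel _ _

/-- The `s`-th derivative of `ω ↦ M (e^{iω}, …, e^{inω})'`, for a real matrix `M`. -/
noncomputable def osc {m : Type*} {n : ℕ} (M : Matrix m (Fin n) ℝ) (s : ℕ) (ω : ℝ) (i : m) : ℂ :=
  ∑ j : Fin n, (M i j : ℂ) * ((Complex.I * ((j : ℂ) + 1)) ^ s *
    Complex.exp (Complex.I * ((j : ℂ) + 1) * ω))

section Osc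

variable {m : Type*} {n : ℕ}

/-- This links derivatives in ω to the matrices E_{n,s}: up to the unit factor i^s, the two columns
of M E_{n,s}(ω) are the real and imaginary parts of the s-th derivative. -/
theorem osc_eq (M : Matrix m (Fin n) ℝ) (s : ℕ) (ω : ℝ) (i : m) :
    osc M s ω i = Complex.I ^ s *
      (((M * Emat n s ω) i 0 : ℝ) + ((M * Emat n s ω) i 1 : ℝ) * Complex.I) := by
  simp only [osc, Matrix.mul_apply, Emat, of_apply, cons_val_zero, cons_val_one,
    Complex.ofReal_sum, Finset.sum_mul, ← Finset.sum_add_distrib, Finset.mul_sum]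
  refine Finset.sum_congr rfl fun j _ => ?_
  have h : Complex.exp (Complex.I * ((j : ℂ) + 1) * ω) =
      Complex.cos (((j : ℂ) + 1) * ω) + Complex.sin (((j : ℂ) + 1) * ω) * Complex.I := by
    rw [← Complex.exp_mul_I]; ring_nf
  rw [h, mul_pow]
  push_cast
  ring

theorem osc_eq_zero_iff (M : Matrix m (Fin n) ℝ) (s : ℕ) (ω : ℝ) :
    osc M s ω = 0 ↔ M * Emat n s ω = 0 := by
  constructor
  · intro h
    ext i a
    have h1 := congrFun h i
    rw [osc_eq, Pi.zero_apply, mul_eq_zero, or_iff_right (pow_ne_zero _ Complex.I_ne_zero)] at h1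
    have h2 := congrArg Complex.re h1
    have h3 := congrArg Complex.im h1
    simp at h2 h3
    fin_cases a
    · simpa using! h2
    · simpa using! h3
  · intro h
    ext i
    rw [osc_eq, h]
    simp

/-- A Vandermonde argument: the exponents i(j+1) are distinct, so if all derivatives of a row's
exponential sum vanish at γ, then so do its coefficients. -/
theorem exists_mul_Emat_ne_zero {M : Matrix m (Fin n) ℝ} (hM : M ≠ 0) (γ : ℝ) :
    ∃ s, M * Emat n s γ ≠ 0 := by
  by_contra! h
  apply hM
  ext i j
  have hinj : Function.Injective fun j : Fin n => Complex.I * ((j : ℂ) + 1) := by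
    intro a b hab
    have := mul_left_cancel₀ Complex.I_ne_zero hab
    exact Fin.ext (Nat.cast_injective (R := ℂ) (add_right_cancel this))
  have h1 := eq_zero_of_forall_pow_sum_mul_pow_eq_zero hinj
    (v := fun j => (M i j : ℂ) * Complex.exp (Complex.I * ((j : ℂ) + 1) * γ)) (fun s => by
      have h2 := congrFun ((osc_eq_zero_iff M s γ).2 (h s)) i
      rw [Pi.zero_apply] at h2
      rw [← h2]
      exact Finset.sum_congr rfl fun j _ => by ring)
  have h3 := congrFun h1 j
  simpa [Complex.exp_ne_zero] using h3

theorem hasDerivAt_osc (M : Matrix m (Fin n) ℝ) (s : ℕ) (ω : ℝ) :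
    HasDerivAt (osc M s) (osc M (s + 1) ω) ω := by
  refine hasDerivAt_pi.2 fun i => ?_
  unfold osc
  refine HasDerivAt.fun_sum fun j _ => ?_
  have h : HasDerivAt (fun z : ℂ => Complex.exp (Complex.I * ((j : ℂ) + 1) * z))
      (Complex.exp (Complex.I * ((j : ℂ) + 1) * ω) * (Complex.I * ((j : ℂ) + 1))) (ω : ℂ) := by
    simpa using ((hasDerivAt_id (ω : ℂ)).const_mul (Complex.I * ((j : ℂ) + 1))).cexp
  refine ((h.comp_ofReal.const_mul ((Complex.I * ((j : ℂ) + 1)) ^ s)).const_mul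
    (M i j : ℂ)).congr_deriv ?_
  rw [pow_succ]
  ring

variable [Fintype m]

theorem iteratedDeriv_osc (M : Matrix m (Fin n) ℝ) (s : ℕ) :
    iteratedDeriv s (osc M 0) = osc M s := by
  induction s with
  | zero => exact iteratedDeriv_zero
  | succ s ih =>
    rw [iteratedDeriv_succ, ih]
    exact funext fun ω => (hasDerivAt_osc M s ω).deriv

theorem contDiff_osc (M : Matrix m (Fin n) ℝ) (s : ℕ) : ContDiff ℝ s (osc M 0) := by
  refine contDiff_of_differentiable_iteratedDeriv fun k _ => ?_
  rw [iteratedDeriv_osc]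
  exact fun ω => (hasDerivAt_osc M k ω).differentiableAt

/-- The squared length of `M (e^{iω}, …, e^{inω})'`. -/
noncomputable def oscSq (M : Matrix m (Fin n) ℝ) (ω : ℝ) : ℝ := ∑ i, ‖osc M 0 ω i‖ ^ 2

theorem oscSq_eq (M : Matrix m (Fin n) ℝ) (ω : ℝ) :
    oscSq M ω = ∑ i, ∑ t : Fin n, ∑ s : Fin n,
      M i t * M i s * Real.cos (((t : ℝ) - (s : ℝ)) * ω) := by
  refine Finset.sum_congr rfl fun i _ => ?_
  rw [osc_eq, pow_zero, one_mul, Complex.sq_norm, Complex.normSq_add_mul_I]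
  simp only [Matrix.mul_apply, Emat, of_apply, cons_val_zero, cons_val_one, pow_zero, one_mul,
    pow_two, Finset.sum_mul_sum, ← Finset.sum_add_distrib]
  refine Finset.sum_congr rfl fun t _ => Finset.sum_congr rfl fun s _ => ?_
  have h : ((t : ℝ) - s) * ω = ((t : ℝ) + 1) * ω - ((s : ℝ) + 1) * ω := by ring
  rw [h, Real.cos_sub]
  ring

theorem oscSq_neg (M : Matrix m (Fin n) ℝ) (ω : ℝ) : oscSq M (-ω) = oscSq M ω := by
  simp only [oscSq_eq, mul_neg, Real.cos_neg]

theorem norm_osc_sq_le (M : Matrix m (Fin n) ℝ) (ω : ℝ) : ‖osc M 0 ω‖ ^ 2 ≤ oscSq M ω := by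
  have h : ‖osc M 0 ω‖ ≤ Real.sqrt (oscSq M ω) := by
    refine (pi_norm_le_iff_of_nonneg (Real.sqrt_nonneg _)).2 fun i => ?_
    refine Real.le_sqrt_of_sq_le ?_
    exact Finset.single_le_sum (f := fun i => ‖osc M 0 ω i‖ ^ 2) (fun _ _ => by positivity)
      (Finset.mem_univ i)
  calc _ ≤ Real.sqrt (oscSq M ω) ^ 2 := by gcongr
    _ = _ := Real.sq_sqrt (Finset.sum_nonneg fun _ _ => by positivity)

theorem oscSq_le (M : Matrix m (Fin n) ℝ) (ω : ℝ) :
    oscSq M ω ≤ Fintype.card m * ‖osc M 0 ω‖ ^ 2 := by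
  calc oscSq M ω ≤ ∑ _i : m, ‖osc M 0 ω‖ ^ 2 := by
        unfold oscSq
        gcongr with i
        exact norm_le_pi_norm (osc M 0 ω) i
    _ = _ := by simp

/-- Matching orders of vanishing give a local bound at each γ. Compactness makes it uniform on [0,
π], and evenness of the squared length carries it to [-π, π]. -/
theorem exists_oscSq_le {l : Type*} [Fintype l] (M : Matrix m (Fin n) ℝ) (N : Matrix l (Fin n) ℝ)
    (h : ∀ γ ∈ Set.Icc 0 Real.pi, ∃ s, (∀ i < s, M * Emat n i γ = 0) ∧
      (∀ i < s, N * Emat n i γ = 0) ∧ N * Emat n s γ ≠ 0) :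
    ∃ c : ℝ, ∀ ω ∈ Set.Icc (-Real.pi) Real.pi, oscSq M ω ≤ c * oscSq N ω := by
  have hloc : ∀ γ ∈ Set.Icc 0 Real.pi, osc M 0 =O[𝓝 γ] osc N 0 := by
    intro γ hγ
    obtain ⟨s, h1, h2, h3⟩ := h γ hγ
    refine isBigO_of_leading_terms (contDiff_osc M s) (contDiff_osc N s) ?_ ?_ ?_
    · intro i hi; rw [iteratedDeriv_osc]; exact (osc_eq_zero_iff M i γ).2 (h1 i hi)
    · intro i hi; rw [iteratedDeriv_osc]; exact (osc_eq_zero_iff N i γ).2 (h2 i hi)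
    · rw [iteratedDeriv_osc]; exact fun h0 => h3 ((osc_eq_zero_iff N s γ).1 h0)
  have hglob : osc M 0 =O[𝓟 (Set.Icc 0 Real.pi)] osc N 0 := by
    refine isCompact_Icc.induction_on (p := fun s => osc M 0 =O[𝓟 s] osc N 0) ?_ ?_ ?_ ?_
    · simp
    · exact fun s t hst ht => ht.mono (principal_mono.2 hst)
    · intro s t hs ht
      rw [← sup_principal]
      exact hs.sup ht
    · intro γ hγ
      obtain ⟨c, hc⟩ := (hloc γ hγ).bound
      exact ⟨_, mem_nhdsWithin_of_mem_nhds hc, Asymptotics.isBigO_principal.2 ⟨c, fun ω hω => hω⟩⟩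
  obtain ⟨c, hc⟩ := Asymptotics.isBigO_principal.1 hglob
  -- The O-bound is in the sup norm; passing to sums of squares costs the factor `Fintype.card m`.
  have hpos : ∀ ω ∈ Set.Icc 0 Real.pi,
      oscSq M ω ≤ (Fintype.card m * c ^ 2) * oscSq N ω := by
    intro ω hω
    calc oscSq M ω ≤ Fintype.card m * ‖osc M 0 ω‖ ^ 2 := oscSq_le M ω
      _ ≤ Fintype.card m * (c * ‖osc N 0 ω‖) ^ 2 := by gcongr; exact hc ω hω
      _ = (Fintype.card m * c ^ 2) * ‖osc N 0 ω‖ ^ 2 := by ring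
      _ ≤ _ := by gcongr; exact norm_osc_sq_le N ω
  refine ⟨Fintype.card m * c ^ 2, fun ω hω => ?_⟩
  rcases le_total 0 ω with h0 | h0
  · exact hpos ω ⟨h0, hω.2⟩
  · rw [← oscSq_neg M, ← oscSq_neg N]
    exact hpos (-ω) ⟨by linarith, by linarith [hω.1]⟩

theorem countable_zeros_oscSq {M : Matrix m (Fin n) ℝ} (hM : M ≠ 0) :
    {ω | oscSq M ω = 0}.Countable := by
  have hz : {ω | oscSq M ω = 0} = {ω | osc M 0 ω = 0} := by
    ext ω
    simp only [Set.mem_ofPred_eq]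
    constructor
    · intro h
      have := norm_osc_sq_le M ω
      rw [h] at this
      exact norm_eq_zero.1 (pow_eq_zero_iff two_ne_zero |>.1 (le_antisymm this (by positivity)))
    · intro h
      simp [oscSq, h]
  obtain ⟨ω₀, hω₀⟩ : ∃ ω, osc M 0 ω ≠ 0 := by
    by_contra! h
    obtain ⟨s, hs⟩ := exists_mul_Emat_ne_zero hM 0
    apply hs
    rw [← osc_eq_zero_iff, ← iteratedDeriv_osc, show osc M 0 = fun _ => 0 from funext h]
    simp
  rw [hz]
  refine countable_zeros_of_analytic (fun ω _ => AnalyticAt.pi fun i => ?_) hω₀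
  unfold osc
  refine Finset.analyticAt_fun_sum _ fun j _ => ?_
  have h1 : AnalyticAt ℝ (fun ω : ℝ => Complex.exp (Complex.I * ((j : ℂ) + 1) * ω)) ω := by
    have h2 : AnalyticAt ℂ (fun z : ℂ => Complex.exp (Complex.I * ((j : ℂ) + 1) * z)) (ω : ℂ) := by
      fun_prop
    exact h2.restrictScalars.comp (Complex.ofRealCLM.analyticAt ω)
  exact analyticAt_const.mul (analyticAt_const.mul h1)

end Osc

/-! ### Spectral covariance matrices -/

section Spectral

variable {n : ℕ} {f : ℝ → ℝ}

theorem integrableOn_cos_mul (hf : IsNormalizedSpectralDensity f) (a : ℝ) :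
    IntegrableOn (fun ω => Real.cos (a * ω) * f ω) (Set.Icc (-Real.pi) Real.pi) := by
  refine hf.integrable.bdd_mul (c := 1) (by fun_prop) (Eventually.of_forall fun ω => ?_)
  exact Real.abs_cos_le_one _

theorem spectralCov_apply (hf : IsNormalizedSpectralDensity f) (j l : Fin n) :
    spectralCov n f j l =
      ∫ ω in Set.Icc (-Real.pi) Real.pi, Real.cos (((j : ℝ) - (l : ℝ)) * ω) * f ω := by
  have hint : IntegrableOn (fun ω : ℝ => Complex.exp (-Complex.I * (((j : ℂ) - (l : ℂ)) * (ω : ℂ))) *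
      (f ω : ℂ)) (Set.Icc (-Real.pi) Real.pi) := by
    refine hf.integrable.ofReal.bdd_mul (c := 1) (by fun_prop) (Eventually.of_forall fun ω => ?_)
    rw [Complex.norm_exp]
    simp
  have h := Complex.reCLM.integral_comp_comm hint
  simp only [Complex.reCLM_apply] at h
  rw [spectralCov, of_apply, ← h]
  refine integral_congr_ae (Eventually.of_forall fun ω => ?_)
  have h2 : -Complex.I * (((j : ℂ) - (l : ℂ)) * (ω : ℂ)) =
      ((-(((j : ℝ) - (l : ℝ)) * ω) : ℝ) : ℂ) * Complex.I := by
    push_cast; ring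
  simp only [Complex.re_mul_ofReal]
  rw [h2, Complex.exp_ofReal_mul_I_re, Real.cos_neg]

theorem integrableOn_oscSq_mul {m : Type*} [Fintype m] (hf : IsNormalizedSpectralDensity f)
    (M : Matrix m (Fin n) ℝ) :
    IntegrableOn (fun ω => oscSq M ω * f ω) (Set.Icc (-Real.pi) Real.pi) := by
  simp only [oscSq_eq, Finset.sum_mul, mul_assoc]
  exact integrable_finsetSum _ fun i _ => integrable_finsetSum _ fun t _ =>
    integrable_finsetSum _ fun s _ => ((integrableOn_cos_mul hf _).const_mul _).const_mul _

/-- The spectral representation of quadratic forms: through it, pointwise inequalities in ω become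
trace inequalities valid for every f at once. -/
theorem integral_oscSq_mul {m : Type*} [Fintype m] (hf : IsNormalizedSpectralDensity f)
    (M : Matrix m (Fin n) ℝ) :
    ∫ ω in Set.Icc (-Real.pi) Real.pi, oscSq M ω * f ω = (M * spectralCov n f * Mᵀ).trace := by
  simp only [oscSq_eq, Finset.sum_mul, mul_assoc]
  have h3 := fun (i : m) (t s : Fin n) =>
    ((integrableOn_cos_mul hf ((t : ℝ) - (s : ℝ))).const_mul (M i s)).const_mul (M i t)
  rw [integral_finsetSum _ fun i _ => integrable_finsetSum _ fun t _ =>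
    integrable_finsetSum _ fun s _ => h3 i t s]
  simp only [trace, diag_apply, mul_mul_transpose_apply, spectralCov_apply hf]
  refine Finset.sum_congr rfl fun i _ => ?_
  rw [integral_finsetSum _ fun t _ => integrable_finsetSum _ fun s _ => h3 i t s]
  refine Finset.sum_congr rfl fun t _ => ?_
  rw [integral_finsetSum _ fun s _ => h3 i t s]
  refine Finset.sum_congr rfl fun s _ => ?_
  rw [integral_const_mul, integral_const_mul]
  ring

theorem oscSq_nonneg {m : Type*} [Fintype m] (M : Matrix m (Fin n) ℝ) (ω : ℝ) : 0 ≤ oscSq M ω :=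
  Finset.sum_nonneg fun _ _ => by positivity

theorem ae_restrict_nonneg (hf : IsNormalizedSpectralDensity f) :
    ∀ᵐ ω ∂(volume.restrict (Set.Icc (-Real.pi) Real.pi)), 0 ≤ f ω :=
  (ae_restrict_mem measurableSet_Icc).mono fun ω hω => hf.nonneg ω hω

/-- The squared length vanishes at only countably many frequencies, so a zero integral would force f
= 0 almost everywhere, against total mass one. -/
theorem trace_mul_spectralCov_pos {m : Type*} [Fintype m] (hf : IsNormalizedSpectralDensity f)
    {M : Matrix m (Fin n) ℝ} (hM : M ≠ 0) : 0 < (M * spectralCov n f * Mᵀ).trace := by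
  rw [← integral_oscSq_mul hf]
  have hnn : 0 ≤ᵐ[volume.restrict (Set.Icc (-Real.pi) Real.pi)] fun ω => oscSq M ω * f ω :=
    (ae_restrict_nonneg hf).mono fun ω hω => mul_nonneg (oscSq_nonneg M ω) hω
  refine lt_of_le_of_ne (integral_nonneg_of_ae hnn) fun h0 => ?_
  have h1 := (integral_eq_zero_iff_of_nonneg_ae hnn (integrableOn_oscSq_mul hf M)).1 h0.symm
  have h2 : f =ᵐ[volume.restrict (Set.Icc (-Real.pi) Real.pi)] fun _ => 0 := by
    filter_upwards [h1, (countable_zeros_oscSq hM).ae_notMem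
      (volume.restrict (Set.Icc (-Real.pi) Real.pi))] with ω h3 h4
    exact (mul_eq_zero.1 h3).resolve_left h4
  have h3 := hf.integral_eq_one
  rw [integral_congr_ae h2] at h3
  simp at h3

theorem spectralCov_posDef (hf : IsNormalizedSpectralDensity f) : (spectralCov n f).PosDef := by
  refine PosDef.of_dotProduct_mulVec_pos ?_ fun x hx => ?_
  · ext i j
    rw [conjTranspose_apply, star_trivial, spectralCov_apply hf, spectralCov_apply hf]
    refine integral_congr_ae (Eventually.of_forall fun ω => ?_)
    have h : ((j : ℝ) - (i : ℝ)) * ω = -(((i : ℝ) - (j : ℝ)) * ω) := by ring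
    simp only [h, Real.cos_neg]
  -- The trace inequality is applied to the one-row matrix x', whose trace form is x'Σx.
  · have hM : (Matrix.of fun (_ : Unit) j => x j) ≠ 0 := by
      intro h
      exact hx (funext fun j => congrFun (congrFun h ()) j)
    have h := trace_mul_spectralCov_pos hf hM
    simp only [trace, diag_apply, mul_mul_transpose_apply, of_apply, Finset.univ_unique,
      Finset.sum_const, Finset.card_singleton, one_smul] at h
    simpa only [star_trivial, dotProduct, mulVec, Finset.mul_sum, mul_assoc, mul_comm,
      mul_left_comm] using h

theorem trace_spectralCov_le {m l : Type*} [Fintype m] [Fintype l]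
    {M : Matrix m (Fin n) ℝ} {N : Matrix l (Fin n) ℝ} {c : ℝ}
    (h : ∀ ω ∈ Set.Icc (-Real.pi) Real.pi, oscSq M ω ≤ c * oscSq N ω)
    (hf : IsNormalizedSpectralDensity f) :
    (M * spectralCov n f * Mᵀ).trace ≤ c * (N * spectralCov n f * Nᵀ).trace := by
  rw [← integral_oscSq_mul hf, ← integral_oscSq_mul hf, ← integral_const_mul]
  refine integral_mono_ae (integrableOn_oscSq_mul hf M)
    ((integrableOn_oscSq_mul hf N).const_mul c) ?_
  filter_upwards [ae_restrict_nonneg hf, ae_restrict_mem measurableSet_Icc] with ω h1 h2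
  rw [← mul_assoc]
  exact mul_le_mul_of_nonneg_right (h ω h2) h1

end Spectral

/-! ### Projections and concentration spaces -/

section Projections

variable {n : ℕ}

theorem toEuclideanCLM_projPerp (L : Submodule ℝ (EuclideanSpace ℝ (Fin n)))
    (x : EuclideanSpace ℝ (Fin n)) :
    toEuclideanCLM (n := Fin n) (𝕜 := ℝ) (projPerp L) x = Lᗮ.starProjection x := by
  simp [projPerp]

theorem projPerp_mulVec_eq_zero_iff (L : Submodule ℝ (EuclideanSpace ℝ (Fin n))) (x : Fin n → ℝ) :
    projPerp L *ᵥ x = 0 ↔ WithLp.toLp 2 x ∈ L := by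
  have h := toEuclideanCLM_projPerp L (WithLp.toLp 2 x)
  rw [toEuclideanCLM_toLp] at h
  have h2 : projPerp L *ᵥ x = 0 ↔ Lᗮ.starProjection (WithLp.toLp 2 x) = 0 := by
    rw [← h]; simp
  rw [h2, Submodule.starProjection_apply_eq_zero_iff, Submodule.orthogonal_orthogonal]

theorem projPerp_transpose (L : Submodule ℝ (EuclideanSpace ℝ (Fin n))) :
    (projPerp L)ᵀ = projPerp L := by
  rw [← conjTranspose_eq_transpose_of_trivial, ← star_eq_conjTranspose, projPerp]
  exact ((toEuclideanCLM (n := Fin n) (𝕜 := ℝ)).symm.map_star' _).symm.trans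
    (congrArg _ (isSelfAdjoint_starProjection Lᗮ))

theorem mem_colSpan_iff {m : Type*} [Fintype m] (A : Matrix (Fin n) m ℝ)
    (x : EuclideanSpace ℝ (Fin n)) : x ∈ colSpan A ↔ ∃ b, x = WithLp.toLp 2 (A *ᵥ b) := by
  rw [colSpan, Submodule.mem_span_range_iff_exists_fun]
  refine exists_congr fun b => ?_
  have : ∑ i, b i • (WithLp.toLp 2 fun j => A j i : EuclideanSpace ℝ (Fin n)) =
      WithLp.toLp 2 (A *ᵥ b) := by
    ext j
    simp [mulVec, dotProduct, mul_comm]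
  rw [this, eq_comm]

theorem projPerp_mul_eq_zero_iff {m : Type*} (L : Submodule ℝ (EuclideanSpace ℝ (Fin n)))
    (A : Matrix (Fin n) m ℝ) : projPerp L * A = 0 ↔ colSpan A ≤ L := by
  rw [colSpan, Submodule.span_le, Set.range_subset_iff]
  simp only [SetLike.mem_coe, ← projPerp_mulVec_eq_zero_iff]
  constructor
  · intro h j
    ext i
    exact congrFun (congrFun h i) j
  · intro h
    ext i j
    exact congrFun (h j) i

theorem continuous_frobNorm : Continuous (frobNorm (n := n)) := by
  unfold frobNorm
  fun_prop

theorem frobNorm_eq_zero_iff (A : Matrix (Fin n) (Fin n) ℝ) : frobNorm A = 0 ↔ A = 0 := by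
  rw [frobNorm, Real.sqrt_eq_zero (by positivity),
    Finset.sum_eq_zero_iff_of_nonneg fun _ _ => by positivity]
  constructor
  · intro h
    ext i j
    have := (Finset.sum_eq_zero_iff_of_nonneg fun _ _ => by positivity).1 (h i (Finset.mem_univ i)) j
      (Finset.mem_univ j)
    exact pow_eq_zero_iff two_ne_zero |>.1 this
  · rintro rfl
    simp

theorem frobNorm_smul (c : ℝ) (A : Matrix (Fin n) (Fin n) ℝ) :
    frobNorm (c • A) = |c| * frobNorm A := by
  simp only [frobNorm, Matrix.smul_apply, smul_eq_mul, mul_pow, ← Finset.mul_sum]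
  rw [Real.sqrt_mul (sq_nonneg c), Real.sqrt_sq_eq_abs]

theorem abs_apply_le_frobNorm (A : Matrix (Fin n) (Fin n) ℝ) (i j : Fin n) :
    |A i j| ≤ frobNorm A := by
  refine Real.abs_le_sqrt ?_
  calc A i j ^ 2 ≤ ∑ l, A i l ^ 2 :=
        Finset.single_le_sum (f := fun l => A i l ^ 2) (fun _ _ => sq_nonneg _) (Finset.mem_univ j)
    _ ≤ _ := Finset.single_le_sum (f := fun i => ∑ l, A i l ^ 2) (fun _ _ => by positivity)
        (Finset.mem_univ i)

variable {L : Submodule ℝ (EuclideanSpace ℝ (Fin n))}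

theorem projPerp_ne_zero (hL : L ≠ ⊤) : projPerp L ≠ 0 := by
  intro h
  refine hL (Submodule.eq_top_iff'.2 fun x => ?_)
  exact (projPerp_mulVec_eq_zero_iff L x.ofLp).1 (by rw [h, zero_mulVec])

theorem frobNorm_projPerp_pos (hL : L ≠ ⊤) {f : ℝ → ℝ} (hf : IsNormalizedSpectralDensity f) :
    0 < frobNorm (projPerp L * spectralCov n f * projPerp L) := by
  refine lt_of_le_of_ne (Real.sqrt_nonneg _) fun h => ?_
  have h1 := (frobNorm_eq_zero_iff _).1 h.symm
  have h2 := trace_mul_spectralCov_pos hf (projPerp_ne_zero hL)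
  rw [projPerp_transpose, h1, trace_zero] at h2
  exact lt_irrefl _ h2

theorem frobNorm_eq_one_of_mem_closure (hL : L ≠ ⊤) {S : Matrix (Fin n) (Fin n) ℝ}
    (hS : S ∈ closure (normProj L '' covModel n Fall)) : frobNorm S = 1 := by
  refine closure_minimal (t := {S | frobNorm S = 1}) ?_
    (isClosed_eq continuous_frobNorm continuous_const) hS
  rintro _ ⟨_, ⟨f, hf, rfl⟩, rfl⟩
  have h := frobNorm_projPerp_pos hL hf
  change frobNorm (normProj L _) = 1
  rw [normProj, frobNorm_smul, abs_of_pos (inv_pos.2 h), inv_mul_cancel₀ h.ne']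

theorem posSemidef_of_mem_closure {S : Matrix (Fin n) (Fin n) ℝ}
    (hS : S ∈ closure (normProj L '' covModel n Fall)) : S.PosSemidef := by
  have hcl : IsClosed {S : Matrix (Fin n) (Fin n) ℝ | S.PosSemidef} := by
    have : {S : Matrix (Fin n) (Fin n) ℝ | S.PosSemidef} =
        {S | Sᵀ = S} ∩ ⋂ x : Fin n → ℝ, {S | 0 ≤ x ⬝ᵥ (S *ᵥ x)} := by
      ext S
      simp only [Set.mem_ofPred_eq, Set.mem_inter_iff, Set.mem_iInter]
      rw [posSemidef_iff_dotProduct_mulVec]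
      simp [IsHermitian]
    rw [this]
    refine (isClosed_eq (by fun_prop) continuous_id).inter (isClosed_iInter fun x => ?_)
    exact isClosed_le continuous_const (by fun_prop)
  refine closure_minimal (t := {S | S.PosSemidef}) ?_ hcl hS
  rintro _ ⟨_, ⟨f, hf, rfl⟩, rfl⟩
  have h := (spectralCov_posDef hf (n := n)).posSemidef.mul_mul_conjTranspose_same (projPerp L)
  rw [conjTranspose_eq_transpose_of_trivial, projPerp_transpose] at h
  exact h.smul (inv_nonneg.2 (Real.sqrt_nonneg _))

/-- Every limit of normalized projected covariance matrices has a column space that contains the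
projection of `span(E_{n,ρ(γ)}(γ))` for some frequency `γ`. -/
theorem exists_frequency_of_mem_closure (hL : L ≠ ⊤) {S : Matrix (Fin n) (Fin n) ℝ}
    (hS : S ∈ closure (normProj L '' covModel n Fall)) :
    ∃ γ ∈ Set.Icc 0 Real.pi, colSpan (projPerp L * Emat n (rho γ L) γ) ≤ colSpan S := by
  by_contra! h
  -- Below order ρ both products vanish by minimality of ρ. At order ρ, QΠE = 0 would be exactly the
  -- inclusion denied by `h`.
  obtain ⟨c, hle⟩ := exists_oscSq_le (projPerp L) (projPerp (colSpan S) * projPerp L)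
    (fun γ hγ => by
      have hlow : ∀ i < rho γ L, projPerp L * Emat n i γ = 0 := fun i hi =>
        (projPerp_mul_eq_zero_iff L _).2 (not_not.1 (Nat.notMem_of_lt_sInf hi))
      refine ⟨rho γ L, hlow, fun i hi => ?_, fun h0 => h γ hγ ?_⟩
      · rw [Matrix.mul_assoc, hlow i hi, Matrix.mul_zero]
      · rwa [Matrix.mul_assoc, projPerp_mul_eq_zero_iff] at h0)
  -- The inequality is homogeneous, so it survives the normalization, and it is closed, so it passes
  -- to the limit S. There it collapses, because Q annihilates the columns of S.
  have htr : S.trace ≤ c * (projPerp (colSpan S) * S * (projPerp (colSpan S))ᵀ).trace := by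
    refine closure_minimal
      (t := {A | A.trace ≤ c * (projPerp (colSpan S) * A * (projPerp (colSpan S))ᵀ).trace}) ?_
      (isClosed_le (f := fun A : Matrix (Fin n) (Fin n) ℝ => A.trace) (by fun_prop)
        (by fun_prop)) hS
    rintro _ ⟨_, ⟨f, hf, rfl⟩, rfl⟩
    have h1 := trace_spectralCov_le hle hf
    rw [transpose_mul, projPerp_transpose L] at h1
    simp only [Set.mem_ofPred_eq, normProj, Matrix.mul_smul, Matrix.smul_mul, trace_smul,
      smul_eq_mul]
    rw [mul_left_comm]
    refine mul_le_mul_of_nonneg_left ?_ (inv_nonneg.2 (Real.sqrt_nonneg _))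
    simpa only [Matrix.mul_assoc] using h1
  rw [(projPerp_mul_eq_zero_iff (colSpan S) S).2 le_rfl, Matrix.zero_mul, trace_zero,
    mul_zero] at htr
  have hpsd := posSemidef_of_mem_closure hS
  have h0 : S = 0 := hpsd.trace_eq_zero_iff.1 (le_antisymm htr hpsd.trace_nonneg)
  have h1 := frobNorm_eq_one_of_mem_closure hL hS
  rw [(frobNorm_eq_zero_iff S).2 h0] at h1
  exact zero_ne_one h1

end Projections

/-! ### Rejection probabilities as functions of a covariance factor -/

/-- The probability that the statistic `T` is at least `C` under the law of `A z`, for a standard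
Gaussian vector `z`. -/
noncomputable def rejProb {n : ℕ} (T : EuclideanSpace ℝ (Fin n) → ℝ)
    (A : Matrix (Fin n) (Fin n) ℝ) (C : ℝ) : ℝ≥0∞ :=
  stdGaussian (EuclideanSpace ℝ (Fin n)) {z | C ≤ T (WithLp.toLp 2 (A *ᵥ z.ofLp))}

/-- Convergence of measures through almost sure convergence of indicators is used along
neighbourhood filters of matrices, which must be countably generated. -/
instance instFirstCountableMatrix {n : ℕ} :
    FirstCountableTopology (Matrix (Fin n) (Fin n) ℝ) :=
  inferInstanceAs (FirstCountableTopology (Fin n → Fin n → ℝ))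

section Abstract

variable {n : ℕ} {num den T : EuclideanSpace ℝ (Fin n) → ℝ}

theorem measurable_of_eq_div (hnum : AnalyticOnNhd ℝ num Set.univ)
    (hden : AnalyticOnNhd ℝ den Set.univ) (hT : ∀ y, T y = num y / den y) : Measurable T := by
  rw [show T = fun y => num y / den y from funext hT]
  exact (continuousOn_univ.1 hnum.continuousOn).measurable.div
    (continuousOn_univ.1 hden.continuousOn).measurable

theorem continuousAt_of_eq_div (hnum : AnalyticOnNhd ℝ num Set.univ)
    (hden : AnalyticOnNhd ℝ den Set.univ) (hT : ∀ y, T y = num y / den y)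
    {y : EuclideanSpace ℝ (Fin n)} (hy : den y ≠ 0) : ContinuousAt T y := by
  rw [show T = fun y => num y / den y from funext hT]
  exact (continuousOn_univ.1 hnum.continuousOn).continuousAt.div
    (continuousOn_univ.1 hden.continuousOn).continuousAt hy

theorem analyticOnNhd_comp_mulVec {f : EuclideanSpace ℝ (Fin n) → ℝ}
    (hf : AnalyticOnNhd ℝ f Set.univ) (A : Matrix (Fin n) (Fin n) ℝ) :
    AnalyticOnNhd ℝ (fun z : EuclideanSpace ℝ (Fin n) => f (WithLp.toLp 2 (A *ᵥ z.ofLp)))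
      Set.univ :=
  hf.comp (fun z _ => (toEuclideanCLM (n := Fin n) (𝕜 := ℝ) A).analyticAt z)
    (fun _ _ => Set.mem_univ _)

theorem measurableSet_le_comp_mulVec (hmeas : Measurable T) (A : Matrix (Fin n) (Fin n) ℝ) (C : ℝ) :
    MeasurableSet {z : EuclideanSpace ℝ (Fin n) | C ≤ T (WithLp.toLp 2 (A *ᵥ z.ofLp))} :=
  measurableSet_le measurable_const
    (hmeas.comp (toEuclideanCLM (n := Fin n) (𝕜 := ℝ) A).continuous.measurable)

theorem continuousAt_comp_mulVec {A : Matrix (Fin n) (Fin n) ℝ} {z : EuclideanSpace ℝ (Fin n)}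
    (h : ContinuousAt T (WithLp.toLp 2 (A *ᵥ z.ofLp))) :
    ContinuousAt (fun B : Matrix (Fin n) (Fin n) ℝ => T (WithLp.toLp 2 (B *ᵥ z.ofLp))) A :=
  ContinuousAt.comp (f := fun B : Matrix (Fin n) (Fin n) ℝ => WithLp.toLp 2 (B *ᵥ z.ofLp)) h
    (by fun_prop)

/-- By analyticity, almost surely den(Az) ≠ 0 and T(Az) ≠ C. For such z the event T(Bz) ≥ C' is
locally constant in (B, C') near (A, C), and dominated convergence applies. -/
theorem continuousAt_rejProb (hnum : AnalyticOnNhd ℝ num Set.univ)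
    (hden : AnalyticOnNhd ℝ den Set.univ) (hT : ∀ y, T y = num y / den y)
    {A : Matrix (Fin n) (Fin n) ℝ} {C : ℝ}
    (h1 : ∃ z : Fin n → ℝ, den (WithLp.toLp 2 (A *ᵥ z)) ≠ 0)
    (h2 : ∃ z : Fin n → ℝ, num (WithLp.toLp 2 (A *ᵥ z)) - C * den (WithLp.toLp 2 (A *ᵥ z)) ≠ 0) :
    ContinuousAt (fun p : Matrix (Fin n) (Fin n) ℝ × ℝ => rejProb T p.1 p.2) (A, C) := by
  have hmeas := measurable_of_eq_div hnum hden hT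
  refine tendsto_measure_of_ae_tendsto_indicator (𝓝 (A, C)) (measurableSet_le_comp_mulVec hmeas A C)
    (fun p => measurableSet_le_comp_mulVec hmeas p.1 p.2) MeasurableSet.univ (measure_ne_top _ _)
    (Eventually.of_forall fun _ => Set.subset_univ _) ?_
  obtain ⟨z₁, hz₁⟩ := h1
  obtain ⟨z₂, hz₂⟩ := h2
  filter_upwards [stdGaussian_ae_ne_zero_of_analytic (analyticOnNhd_comp_mulVec hden A)
      (x₀ := WithLp.toLp 2 z₁) hz₁,
    stdGaussian_ae_ne_zero_of_analytic (analyticOnNhd_comp_mulVec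
      (hnum.sub (analyticOnNhd_const.mul hden)) A) (x₀ := WithLp.toLp 2 z₂) hz₂] with z hz hz'
  have hc : ContinuousAt (fun p : Matrix (Fin n) (Fin n) ℝ × ℝ =>
      T (WithLp.toLp 2 (p.1 *ᵥ z.ofLp))) (A, C) :=
    ContinuousAt.comp (x := (A, C)) (f := Prod.fst)
      (g := fun B : Matrix (Fin n) (Fin n) ℝ => T (WithLp.toLp 2 (B *ᵥ z.ofLp)))
      (continuousAt_comp_mulVec (continuousAt_of_eq_div hnum hden hT hz)) continuousAt_fst
  have hne : T (WithLp.toLp 2 (A *ᵥ z.ofLp)) ≠ C := by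
    rw [hT, Ne, div_eq_iff hz]
    exact fun h => hz' (sub_eq_zero.2 h)
  rcases hne.lt_or_gt with h | h
  · filter_upwards [hc.eventually_lt continuousAt_snd h] with p hp
    exact iff_of_false (not_le.2 hp) (not_le.2 h)
  · filter_upwards [continuousAt_snd.eventually_lt hc h] with p hp
    exact iff_of_true hp.le h.le

/-- For almost every z, T(Bz) stays bounded for B near A while the threshold grows. Convergence is
joint in (B, C), which is what yields uniformity over compact sets. -/
theorem tendsto_rejProb_zero (hnum : AnalyticOnNhd ℝ num Set.univ)
    (hden : AnalyticOnNhd ℝ den Set.univ) (hT : ∀ y, T y = num y / den y)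
    {A : Matrix (Fin n) (Fin n) ℝ} (h1 : ∃ z : Fin n → ℝ, den (WithLp.toLp 2 (A *ᵥ z)) ≠ 0) :
    Tendsto (fun p : Matrix (Fin n) (Fin n) ℝ × ℝ => rejProb T p.1 p.2) (𝓝 A ×ˢ atTop) (𝓝 0) := by
  have hmeas := measurable_of_eq_div hnum hden hT
  rw [← measure_empty (μ := stdGaussian (EuclideanSpace ℝ (Fin n)))]
  refine tendsto_measure_of_ae_tendsto_indicator _ MeasurableSet.empty
    (fun p => measurableSet_le_comp_mulVec hmeas p.1 p.2) MeasurableSet.univ (measure_ne_top _ _)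
    (Eventually.of_forall fun _ => Set.subset_univ _) ?_
  obtain ⟨z₁, hz₁⟩ := h1
  filter_upwards [stdGaussian_ae_ne_zero_of_analytic (analyticOnNhd_comp_mulVec hden A)
    (x₀ := WithLp.toLp 2 z₁) hz₁] with z hz
  have hc := continuousAt_comp_mulVec (continuousAt_of_eq_div hnum hden hT hz)
  have hb : ∀ᶠ B in 𝓝 A, T (WithLp.toLp 2 (B *ᵥ z.ofLp)) < T (WithLp.toLp 2 (A *ᵥ z.ofLp)) + 1 :=
    hc.eventually_lt continuousAt_const (lt_add_one _)
  filter_upwards [hb.prod_mk (eventually_ge_atTop (T (WithLp.toLp 2 (A *ᵥ z.ofLp)) + 1))] with p hp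
  exact iff_of_false (not_le.2 (hp.1.trans_le hp.2)) id

theorem eventually_rejProb_le (hnum : AnalyticOnNhd ℝ num Set.univ)
    (hden : AnalyticOnNhd ℝ den Set.univ) (hT : ∀ y, T y = num y / den y)
    {K : Set (Matrix (Fin n) (Fin n) ℝ)} (hK : IsCompact K)
    (h1 : ∀ A ∈ K, ∃ z : Fin n → ℝ, den (WithLp.toLp 2 (A *ᵥ z)) ≠ 0) {ε : ℝ≥0∞} (hε : 0 < ε) :
    ∀ᶠ C in atTop, ∀ A ∈ K, rejProb T A C ≤ ε := by
  have h : ∀ᶠ p in 𝓝ˢ K ×ˢ (atTop : Filter ℝ), rejProb T p.1 p.2 ≤ ε := by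
    rw [hK.nhdsSet_prod_eq_biSup]
    simp only [eventually_iSup]
    exact fun A hA => ((tendsto_rejProb_zero hnum hden hT (h1 A hA)).eventually_lt_const hε).mono
      fun _ hp => hp.le
  obtain ⟨p, hp, q, hq, hpq⟩ := eventually_prod_iff.1 h
  exact hq.mono fun C hC A hA => hpq (hp.self_of_nhdsSet A hA) hC

/-- Continuity in A lets the supremum over `K₀` be replaced by that over its compact closure, where
a supremum of a jointly continuous function is continuous. -/
theorem continuousOn_iSup_rejProb (hnum : AnalyticOnNhd ℝ num Set.univ)
    (hden : AnalyticOnNhd ℝ den Set.univ) (hT : ∀ y, T y = num y / den y)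
    {K₀ : Set (Matrix (Fin n) (Fin n) ℝ)} (hK : IsCompact (closure K₀)) {I : Set ℝ}
    (h1 : ∀ A ∈ closure K₀, ∃ z : Fin n → ℝ, den (WithLp.toLp 2 (A *ᵥ z)) ≠ 0)
    (h2 : ∀ C ∈ I, ∀ A ∈ closure K₀, ∃ z : Fin n → ℝ,
      num (WithLp.toLp 2 (A *ᵥ z)) - C * den (WithLp.toLp 2 (A *ᵥ z)) ≠ 0) :
    ContinuousOn (fun C => ⨆ A ∈ K₀, rejProb T A C) I := by
  have hcomp : CompactSpace (closure K₀) := isCompact_iff_compactSpace.1 hK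
  have hcont : Continuous ↿(fun (C : I) (A : closure K₀) => rejProb T A.1 C.1) := by
    refine continuous_iff_continuousAt.2 fun p => ?_
    exact ContinuousAt.comp (f := fun p : I × closure K₀ => (p.2.1, p.1.1)) (x := p)
      (continuousAt_rejProb hnum hden hT (h1 _ p.2.2) (h2 _ p.1.2 _ p.2.2)) (by fun_prop)
  have hs := isCompact_univ.continuous_sSup hcont
  rw [continuousOn_iff_continuous_domRestrict]
  refine hs.congr fun C => ?_
  rw [Set.image_univ, Set.domRestrict_apply]
  refine le_antisymm (sSup_le ?_) (iSup₂_le fun A hA => le_sSup ⟨⟨A, subset_closure hA⟩, rfl⟩)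
  rintro _ ⟨A, rfl⟩
  have hA := continuousAt_rejProb hnum hden hT (h1 _ A.2) (h2 _ C.2 _ A.2)
  have hA' : Tendsto (fun B => rejProb T B C.1) (𝓝 A.1) (𝓝 (rejProb T A.1 C.1)) :=
    ContinuousAt.comp (f := fun B : Matrix (Fin n) (Fin n) ℝ => (B, C.1)) hA (by fun_prop)
  exact le_of_tendsto_of_frequently hA' ((mem_closure_iff_frequently.1 A.2).mono fun B hB =>
    le_iSup₂ (f := fun B (_ : B ∈ K₀) => rejProb T B C.1) B hB)

end Abstract

/-! ### Factors of the normalized projected covariance matrices -/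

section Factors

variable {n : ℕ} {L : Submodule ℝ (EuclideanSpace ℝ (Fin n))}

/-- The factor `‖Π S Π‖^{-1/2} Π S^{1/2}` of the normalized projection of `S`. -/
noncomputable def normFactor (L : Submodule ℝ (EuclideanSpace ℝ (Fin n)))
    (S : Matrix (Fin n) (Fin n) ℝ) : Matrix (Fin n) (Fin n) ℝ :=
  (Real.sqrt (frobNorm (projPerp L * S * projPerp L)))⁻¹ • (projPerp L * CFC.sqrt S)

theorem sqrt_transpose (S : Matrix (Fin n) (Fin n) ℝ) : (CFC.sqrt S)ᵀ = CFC.sqrt S := by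
  rw [← conjTranspose_eq_transpose_of_trivial]
  exact (CFC.sqrt_nonneg S).isSelfAdjoint

theorem normFactor_mul_transpose {S : Matrix (Fin n) (Fin n) ℝ} (hS : S.PosSemidef) :
    normFactor L S * (normFactor L S)ᵀ = normProj L S := by
  have h : projPerp L * CFC.sqrt S * (CFC.sqrt S * projPerp L) = projPerp L * S * projPerp L := by
    rw [Matrix.mul_assoc, ← Matrix.mul_assoc (CFC.sqrt S), CFC.sqrt_mul_sqrt_self S hS.nonneg,
      Matrix.mul_assoc]
  rw [normFactor, normProj, transpose_smul, transpose_mul, sqrt_transpose, projPerp_transpose,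
    Matrix.smul_mul, Matrix.mul_smul, smul_smul, ← mul_inv,
    Real.mul_self_sqrt (show 0 ≤ frobNorm _ from Real.sqrt_nonneg _), h]

/-- Taking limits of factors rather than of covariances means that only continuity of A ↦ AA' is
used, and no continuity of the matrix square root. -/
theorem normFactor_mul_transpose_mem_closure {A : Matrix (Fin n) (Fin n) ℝ}
    (hA : A ∈ closure (normFactor L '' covModel n Fall)) :
    A * Aᵀ ∈ closure (normProj L '' covModel n Fall) := by
  refine map_mem_closure (f := fun A : Matrix (Fin n) (Fin n) ℝ => A * Aᵀ) (by fun_prop) hA ?_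
  rintro _ ⟨_, ⟨f, hf, rfl⟩, rfl⟩
  exact ⟨_, ⟨f, hf, rfl⟩, (normFactor_mul_transpose (spectralCov_posDef hf).posSemidef).symm⟩

/-- The rows of A have squared lengths equal to the diagonal entries of AA', which are at most its
Frobenius norm, namely 1. -/
theorem isCompact_closure_normFactor (hL : L ≠ ⊤) :
    IsCompact (closure (normFactor L '' covModel n Fall)) := by
  have hbox : IsCompact {A : Matrix (Fin n) (Fin n) ℝ | ∀ i, A i ∈ {a | ∀ j, a j ∈ Set.Icc (-1) 1}} :=
    isCompact_pi_infinite fun _ => isCompact_pi_infinite fun _ => isCompact_Icc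
  refine hbox.of_isClosed_subset isClosed_closure fun A hA i j => ?_
  have h1 := frobNorm_eq_one_of_mem_closure hL (normFactor_mul_transpose_mem_closure hA)
  have h2 := abs_apply_le_frobNorm (A * Aᵀ) i i
  rw [h1] at h2
  have h3 : A i j ^ 2 ≤ (A * Aᵀ) i i := by
    simp only [Matrix.mul_apply, transpose_apply, ← pow_two]
    exact Finset.single_le_sum (f := fun j => A i j ^ 2) (fun _ _ => sq_nonneg _)
      (Finset.mem_univ j)
  exact abs_le.1 (abs_le_one_iff_mul_self_le_one.2
    (by rw [← pow_two]; exact h3.trans ((le_abs_self _).trans h2)))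

theorem finrank_colSpan {m : Type*} [Fintype m] (A : Matrix (Fin n) m ℝ) :
    Module.finrank ℝ (colSpan A) = A.rank := by
  have h : colSpan A = (Submodule.span ℝ (Set.range A.col)).map
      ((WithLp.linearEquiv 2 ℝ (Fin n → ℝ)).symm : (Fin n → ℝ) →ₗ[ℝ] EuclideanSpace ℝ (Fin n)) := by
    rw [Submodule.map_span, ← Set.range_comp]
    rfl
  rw [h, rank_eq_finrank_span_cols]
  exact LinearEquiv.finrank_map_eq (WithLp.linearEquiv 2 ℝ (Fin n → ℝ)).symm _

theorem colSpan_mul_transpose (A : Matrix (Fin n) (Fin n) ℝ) : colSpan (A * Aᵀ) = colSpan A := by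
  refine Submodule.eq_of_le_of_finrank_eq ?_ ?_
  · intro x hx
    obtain ⟨b, rfl⟩ := (mem_colSpan_iff _ _).1 hx
    exact (mem_colSpan_iff _ _).2 ⟨Aᵀ *ᵥ b, by rw [mulVec_mulVec]⟩
  · rw [finrank_colSpan, finrank_colSpan, rank_self_mul_transpose]

theorem toLp_projPerp_mulVec (L : Submodule ℝ (EuclideanSpace ℝ (Fin n))) (x : Fin n → ℝ) :
    WithLp.toLp 2 (projPerp L *ᵥ x) = Lᗮ.starProjection (WithLp.toLp 2 x) := by
  rw [← toEuclideanCLM_toLp, toEuclideanCLM_projPerp]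

theorem colSpan_le_orthogonal_of_mem_closure {A : Matrix (Fin n) (Fin n) ℝ}
    (hA : A ∈ closure (normFactor L '' covModel n Fall)) : colSpan A ≤ Lᗮ := by
  intro x hx
  obtain ⟨b, rfl⟩ := (mem_colSpan_iff _ _).1 hx
  have hcl : IsClosed {A : Matrix (Fin n) (Fin n) ℝ | WithLp.toLp 2 (A *ᵥ b) ∈ Lᗮ} :=
    (Submodule.isClosed_orthogonal L).preimage
      (f := fun A : Matrix (Fin n) (Fin n) ℝ => WithLp.toLp 2 (A *ᵥ b)) (by fun_prop)
  refine closure_minimal ?_ hcl hA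
  rintro _ ⟨S, _, rfl⟩
  change WithLp.toLp 2 (normFactor L S *ᵥ b) ∈ Lᗮ
  rw [normFactor, smul_mulVec, ← mulVec_mulVec, WithLp.toLp_smul, toLp_projPerp_mulVec]
  exact Submodule.smul_mem _ _ (Submodule.starProjection_apply_mem _ _)

/-- Σ(f) is nonsingular, so a factor coming from an actual spectral density, unlike a limit, still
reaches all of the range of Π. -/
theorem exists_normFactor_mulVec_eq (hL : L ≠ ⊤) {f : ℝ → ℝ} (hf : IsNormalizedSpectralDensity f)
    (x : Fin n → ℝ) : ∃ z, normFactor L (spectralCov n f) *ᵥ z = projPerp L *ᵥ x := by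
  have hS := spectralCov_posDef hf (n := n)
  have hdet : IsUnit (CFC.sqrt (spectralCov n f)).det := by
    have h : (CFC.sqrt (spectralCov n f)).det * (CFC.sqrt (spectralCov n f)).det ≠ 0 := by
      rw [← det_mul, CFC.sqrt_mul_sqrt_self _ hS.posSemidef.nonneg]
      exact hS.det_pos.ne'
    exact (left_ne_zero_of_mul h).isUnit
  have hc : Real.sqrt (frobNorm (projPerp L * spectralCov n f * projPerp L)) ≠ 0 :=
    (Real.sqrt_pos.2 (frobNorm_projPerp_pos hL hf)).ne'
  refine ⟨Real.sqrt (frobNorm (projPerp L * spectralCov n f * projPerp L)) •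
    ((CFC.sqrt (spectralCov n f))⁻¹ *ᵥ x), ?_⟩
  rw [normFactor, smul_mulVec, mulVec_smul, smul_smul, inv_mul_cancel₀ hc, one_smul, mulVec_mulVec,
    Matrix.mul_assoc, mul_nonsing_inv _ hdet, Matrix.mul_one]

end Factors

/-! ### Reduction of the size of `T_w` to covariance factors -/

section Concrete

variable {n k q : ℕ} {X : Matrix (Fin n) (Fin k) ℝ} {R : Matrix (Fin q) (Fin k) ℝ}
  {r : Fin q → ℝ} {w : ℤ → ℝ}

theorem nullMeansLin_ne_top (hkn : k < n) : nullMeansLin X R r ≠ ⊤ := by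
  intro h
  have hle : nullMeansLin X R r ≤ colSpan X := fun l hl => by
    obtain ⟨b, rfl, -⟩ := nullMeansLin_subset hl
    exact (mem_colSpan_iff _ _).2 ⟨b, rfl⟩
  have h1 := Submodule.finrank_mono hle
  rw [h, finrank_top, finrank_colSpan, finrank_euclideanSpace_fin] at h1
  have h2 := rank_le_width X
  omega

theorem nullMeans_nonempty (hR : R.rank = q) : (nullMeans X R r).Nonempty := by
  obtain ⟨b, hb⟩ := mulVec_surjective hR r
  exact ⟨_, b, rfl, hb⟩

theorem sub_projPerp_mem (x : Fin n → ℝ) (L : Submodule ℝ (EuclideanSpace ℝ (Fin n))) :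
    WithLp.toLp 2 x - WithLp.toLp 2 (projPerp L *ᵥ x) ∈ L := by
  rw [toLp_projPerp_mulVec]
  have h := Submodule.sub_starProjection_mem_orthogonal (K := Lᗮ) (WithLp.toLp 2 x)
  rwa [Submodule.orthogonal_orthogonal] at h

theorem exists_eq_projPerp_add (X : Matrix (Fin n) (Fin k) ℝ) (R : Matrix (Fin q) (Fin k) ℝ)
    (r : Fin q → ℝ) (x : Fin n → ℝ) :
    ∃ b, R *ᵥ b = 0 ∧ (WithLp.toLp 2 x : EuclideanSpace ℝ (Fin n)) =
      WithLp.toLp 2 (projPerp (nullMeansLin X R r) *ᵥ x) + WithLp.toLp 2 (X *ᵥ b) := by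
  obtain ⟨b, hb, hb0⟩ := nullMeansLin_subset (sub_projPerp_mem x (nullMeansLin X R r))
  exact ⟨b, hb0, by rw [← hb, add_sub_cancel]⟩

theorem statDen_projPerp (hn : 0 < n) (hX : X.rank = k) (r : Fin q → ℝ) (x : Fin n → ℝ) :
    statDen X R w (WithLp.toLp 2 (projPerp (nullMeansLin X R r) *ᵥ x)) =
      statDen X R w (WithLp.toLp 2 x) := by
  obtain ⟨b, -, hb⟩ := exists_eq_projPerp_add X R r x
  rw [hb, statDen, statDen, omegaHat_add_mulVec hn hX]

theorem statNum_projPerp (hn : 0 < n) (hX : X.rank = k) (r : Fin q → ℝ) (x : Fin n → ℝ) :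
    statNum X R w (WithLp.toLp 2 (projPerp (nullMeansLin X R r) *ᵥ x)) =
      statNum X R w (WithLp.toLp 2 x) := by
  obtain ⟨b, hb0, hb⟩ := exists_eq_projPerp_add X R r x
  rw [hb, statNum, statNum, omegaHat_add_mulVec hn hX, olsBeta_add, olsBeta_mulVec hX, mulVec_add,
    hb0, add_zero]

theorem Tw_projPerp (hn : 0 < n) (hX : X.rank = k) (r : Fin q → ℝ) (x : Fin n → ℝ) :
    Tw X R 0 w (WithLp.toLp 2 (projPerp (nullMeansLin X R r) *ᵥ x)) =
      Tw X R 0 w (WithLp.toLp 2 x) := by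
  rw [Tw_eq_div, Tw_eq_div, statDen_projPerp hn hX, statNum_projPerp hn hX]

theorem Tw_add_of_mem_nullMeans (hn : 0 < n) (hX : X.rank = k) {μ : EuclideanSpace ℝ (Fin n)}
    (hμ : μ ∈ nullMeans X R r) (y : EuclideanSpace ℝ (Fin n)) :
    Tw X R r w (μ + y) = Tw X R 0 w y := by
  obtain ⟨b, rfl, hb⟩ := hμ
  rw [add_comm, ← Tw_add_mulVec (r := 0) hn hX w hb y, zero_add]

theorem measurable_Tw_zero (hn : 0 < n) : Measurable (Tw X R 0 w) :=
  measurable_of_eq_div (statNum_analytic hn w) (statDen_analytic hn w) (Tw_eq_div w)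

theorem measurable_Tw (hn : 0 < n) (hX : X.rank = k) (hR : R.rank = q) :
    Measurable (Tw X R r w) := by
  obtain ⟨μ, hμ⟩ := nullMeans_nonempty (X := X) (r := r) hR
  have h : Tw X R r w = fun y => Tw X R 0 w (y - μ) := by
    ext y
    rw [← Tw_add_of_mem_nullMeans hn hX hμ, add_sub_cancel]
  rw [h]
  exact (measurable_Tw_zero hn).comp (measurable_id.sub_const μ)

theorem sqrt_smul_of_posSemidef {S : Matrix (Fin n) (Fin n) ℝ} (hS : S.PosSemidef) {c : ℝ}
    (hc : 0 ≤ c) : CFC.sqrt (c • S) = Real.sqrt c • CFC.sqrt S := by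
  refine CFC.sqrt_unique ?_ ?_
  · rw [Matrix.smul_mul, Matrix.mul_smul, smul_smul, CFC.sqrt_mul_sqrt_self S hS.nonneg,
      Real.mul_self_sqrt hc]
  · exact ((nonneg_iff_posSemidef.1 (CFC.sqrt_nonneg S)).smul (Real.sqrt_nonneg c)).nonneg

theorem multivariateGaussian_apply {μ : EuclideanSpace ℝ (Fin n)} {S : Matrix (Fin n) (Fin n) ℝ}
    (hS : S.PosSemidef) {c : ℝ} (hc : 0 ≤ c) {W : Set (EuclideanSpace ℝ (Fin n))}
    (hW : MeasurableSet W) :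
    multivariateGaussian μ (c • S) W = stdGaussian (EuclideanSpace ℝ (Fin n))
      {z | μ + Real.sqrt c • WithLp.toLp 2 (CFC.sqrt S *ᵥ z.ofLp) ∈ W} := by
  rw [multivariateGaussian, Measure.map_apply (by fun_prop) hW, sqrt_smul_of_posSemidef hS hc]
  refine congrArg _ (Set.ext fun z => ?_)
  have h : toEuclideanCLM (n := Fin n) (𝕜 := ℝ) (Real.sqrt c • CFC.sqrt S) z =
      Real.sqrt c • WithLp.toLp 2 (CFC.sqrt S *ᵥ z.ofLp) := by
    rw [← WithLp.toLp_smul, ← smul_mulVec]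
    rfl
  rw [Set.mem_preimage, h]
  rfl

/-- Translation invariance removes the mean, scale invariance removes σ and the normalizing
constant, and invariance under `𝔐₀^lin` allows Π to be inserted. -/
theorem gaussian_rejection_eq (hn : 0 < n) (hX : X.rank = k) (hkn : k < n) (hR : R.rank = q)
    {μ : EuclideanSpace ℝ (Fin n)} (hμ : μ ∈ nullMeans X R r) {σ2 : ℝ} (hσ : 0 < σ2) {f : ℝ → ℝ}
    (hf : IsNormalizedSpectralDensity f) (C : ℝ) :
    multivariateGaussian μ (σ2 • spectralCov n f) {y | C ≤ Tw X R r w y} =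
      rejProb (Tw X R 0 w) (normFactor (nullMeansLin X R r) (spectralCov n f)) C := by
  have hS := (spectralCov_posDef hf (n := n)).posSemidef
  have hc : (Real.sqrt (frobNorm (projPerp (nullMeansLin X R r) * spectralCov n f *
      projPerp (nullMeansLin X R r))))⁻¹ ≠ 0 :=
    inv_ne_zero (Real.sqrt_pos.2 (frobNorm_projPerp_pos (nullMeansLin_ne_top hkn) hf)).ne'
  rw [multivariateGaussian_apply hS hσ.le
    (measurableSet_le measurable_const (measurable_Tw hn hX hR)), rejProb]
  refine congrArg _ (Set.ext fun z => ?_)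
  simp only [Set.mem_ofPred_eq]
  rw [Tw_add_of_mem_nullMeans hn hX hμ, Tw_smul hn w (Real.sqrt_pos.2 hσ).ne', normFactor,
    smul_mulVec, WithLp.toLp_smul, Tw_smul hn w hc, ← mulVec_mulVec, Tw_projPerp hn hX]

theorem Fall_nonempty : Fall.Nonempty := by
  refine ⟨fun _ => (2 * Real.pi)⁻¹, ?_, fun _ _ => rfl, ?_, ?_⟩
  · intro _ _; have := Real.pi_pos; positivity
  · exact integrableOn_const (by simp)
  · have := Real.pi_pos
    simp
    rw [max_eq_left (by linarith)]
    field_simp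
    ring

theorem size_eq_iSup_rejProb (hn : 0 < n) (hX : X.rank = k) (hkn : k < n) (hR : R.rank = q)
    (C : ℝ) :
    size (nullMeans X R r) (covModel n Fall) {y | C ≤ Tw X R r w y} =
      ⨆ A ∈ normFactor (nullMeansLin X R r) '' covModel n Fall, rejProb (Tw X R 0 w) A C := by
  refine le_antisymm (iSup₂_le fun μ hμ => iSup₂_le fun σ2 hσ => iSup₂_le ?_) (iSup₂_le ?_)
  · rintro _ ⟨f, hf, rfl⟩
    rw [gaussian_rejection_eq hn hX hkn hR hμ hσ hf]
    exact le_iSup₂ (f := fun A (_ : A ∈ normFactor (nullMeansLin X R r) '' covModel n Fall) =>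
      rejProb (Tw X R 0 w) A C) _ ⟨_, ⟨f, hf, rfl⟩, rfl⟩
  · rintro _ ⟨_, ⟨f, hf, rfl⟩, rfl⟩
    obtain ⟨μ, hμ⟩ := nullMeans_nonempty (X := X) (r := r) hR
    rw [← gaussian_rejection_eq hn hX hkn hR hμ one_pos hf]
    unfold size
    refine le_iSup₂_of_le μ hμ (le_iSup₂_of_le 1 (Set.mem_Ioi.2 one_pos) ?_)
    exact le_iSup₂ (f := fun S (_ : S ∈ covModel n Fall) =>
      multivariateGaussian μ ((1 : ℝ) • S) {y | C ≤ Tw X R r w y}) _ ⟨f, hf, rfl⟩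

theorem size_antitone (M₀ : Set (EuclideanSpace ℝ (Fin n))) (𝔠 : Set (Matrix (Fin n) (Fin n) ℝ))
    (T : EuclideanSpace ℝ (Fin n) → ℝ) : Antitone fun C : ℝ => size M₀ 𝔠 {y | C ≤ T y} :=
  fun _ _ h => iSup₂_mono fun _ _ => iSup₂_mono fun _ _ => iSup₂_mono fun _ _ =>
    measure_mono fun _ hy => le_trans h hy

/-- The denominator of the statistic does not vanish identically on the range of any factor of a
limit covariance matrix. -/
theorem exists_statDen_ne_zero (hn : 0 < n) (hX : X.rank = k) (hkn : k < n)
    (hw : AssumptionAW n w) (hNI : NonIncl X R r) {A : Matrix (Fin n) (Fin n) ℝ}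
    (hA : A ∈ closure (normFactor (nullMeansLin X R r) '' covModel n Fall)) :
    ∃ z : Fin n → ℝ, statDen X R w (WithLp.toLp 2 (A *ᵥ z)) ≠ 0 := by
  obtain ⟨γ, hγ, hle⟩ := exists_frequency_of_mem_closure (nullMeansLin_ne_top hkn)
    (normFactor_mul_transpose_mem_closure hA)
  -- A point of span(E) outside `𝖡` has Ω̂ nonsingular. Its projection lies in the range of A and
  -- has the same Ω̂.
  obtain ⟨y, hy, hyB⟩ := Set.not_subset.1 (hNI γ hγ)
  obtain ⟨b, rfl⟩ := (mem_colSpan_iff _ _).1 hy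
  rw [colSpan_mul_transpose] at hle
  obtain ⟨z, hz⟩ := (mem_colSpan_iff _ _).1 (hle ((mem_colSpan_iff _ _).2 ⟨b, rfl⟩))
  refine ⟨z, ?_⟩
  rw [← hz, ← mulVec_mulVec, statDen_projPerp hn hX]
  exact (det_omegaHat_ne_zero_iff hn hw _).2 hyB

theorem exists_sub_ne_zero_of_projPerp (hn : 0 < n) (hq : 1 ≤ q) (hX : X.rank = k)
    (hR : R.rank = q) (hw : AssumptionAW n w) {A : Matrix (Fin n) (Fin n) ℝ}
    (hden : ∃ y, statDen X R w y ≠ 0)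
    (hA : ∀ x, ∃ z, A *ᵥ z = projPerp (nullMeansLin X R r) *ᵥ x) (C : ℝ) :
    ∃ z : Fin n → ℝ, statNum X R w (WithLp.toLp 2 (A *ᵥ z)) -
      C * statDen X R w (WithLp.toLp 2 (A *ᵥ z)) ≠ 0 := by
  obtain ⟨y, hy⟩ := hden
  obtain ⟨x, hx⟩ := exists_statNum_sub_ne_zero hn hq hX hR hw hy C
  obtain ⟨z, hz⟩ := hA x.ofLp
  refine ⟨z, ?_⟩
  rw [hz, statNum_projPerp hn hX, statDen_projPerp hn hX]
  exact hx

/-- The denominator is analytic and not identically zero on V, so its zeros there are Lebesgue null;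
off them the quotient equals C. -/
theorem ae_affineLebesgue_Tw_eq (hn : 0 < n) (hX : X.rank = k) (hR : R.rank = q)
    {μ : EuclideanSpace ℝ (Fin n)} (hμ : μ ∈ nullMeans X R r)
    {V : Submodule ℝ (EuclideanSpace ℝ (Fin n))} {C : ℝ} (hden : ∃ v ∈ V, statDen X R w v ≠ 0)
    (hC : ∀ v ∈ V, statNum X R w v = C * statDen X R w v) :
    ∀ᵐ y ∂(affineLebesgue μ V), Tw X R r w y = C := by
  have hcont : Continuous fun x : EuclideanSpace ℝ (Fin (Module.finrank ℝ V)) =>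
      (((stdOrthonormalBasis ℝ V).repr.symm x : V) : EuclideanSpace ℝ (Fin n)) := by fun_prop
  have hmeas : Measurable fun x : EuclideanSpace ℝ (Fin (Module.finrank ℝ V)) =>
      μ + (((stdOrthonormalBasis ℝ V).repr.symm x : V) : EuclideanSpace ℝ (Fin n)) :=
    (continuous_const.add hcont).measurable
  rw [affineLebesgue, ae_map_iff hmeas.aemeasurable
    (measurableSet_eq_fun (measurable_Tw hn hX hR) measurable_const)]
  obtain ⟨v, hv, hv0⟩ := hden
  have han : AnalyticOnNhd ℝ (fun x : EuclideanSpace ℝ (Fin (Module.finrank ℝ V)) =>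
      statDen X R w ((stdOrthonormalBasis ℝ V).repr.symm x : V)) Set.univ := by
    refine (statDen_analytic hn w).comp (fun x _ => ?_) (fun _ _ => Set.mem_univ _)
    exact (V.subtypeL.comp ((stdOrthonormalBasis ℝ V).repr.symm.toContinuousLinearEquiv :
      EuclideanSpace ℝ (Fin (Module.finrank ℝ V)) →L[ℝ] V)).analyticAt x
  filter_upwards [volume_ae_ne_zero_of_analytic han
    (x₀ := (stdOrthonormalBasis ℝ V).repr ⟨v, hv⟩) (by simpa using hv0)] with x hx
  rw [Tw_add_of_mem_nullMeans hn hX hμ, Tw_eq_div, hC _ (Submodule.coe_mem _),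
    mul_div_cancel_right₀ _ hx]

theorem exists_sub_ne_zero_of_Cstar_lt (hn : 0 < n) (hq : 1 ≤ q) (hX : X.rank = k) (hkn : k < n)
    (hR : R.rank = q) (hw : AssumptionAW n w) (hNI : NonIncl X R r) {C : ℝ}
    (hC : Cstar (nullMeans X R r) (nullMeansLin X R r) (covModel n Fall) (Tw X R r w) < C)
    {A : Matrix (Fin n) (Fin n) ℝ}
    (hA : A ∈ closure (normFactor (nullMeansLin X R r) '' covModel n Fall)) :
    ∃ z : Fin n → ℝ, statNum X R w (WithLp.toLp 2 (A *ᵥ z)) -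
      C * statDen X R w (WithLp.toLp 2 (A *ᵥ z)) ≠ 0 := by
  obtain ⟨z₀, hz₀⟩ := exists_statDen_ne_zero hn hX hkn hw hNI hA
  -- If A is rank deficient, its range is a concentration space and identical vanishing would make C
  -- one of the constants bounded by C*. Otherwise the range is all of the orthogonal complement of
  -- `𝔐₀^lin`, and vanishing there would mean vanishing on ℝⁿ.
  by_cases hrank : (A * Aᵀ).rank + Module.finrank ℝ (nullMeansLin X R r) < n
  · by_contra! h
    refine hC.not_ge (le_sSup ?_)
    obtain ⟨μ, hμ⟩ := nullMeans_nonempty (X := X) (r := r) hR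
    refine ⟨_, ⟨_, normFactor_mul_transpose_mem_closure hA, hrank, rfl⟩, μ, hμ, C, ?_, rfl⟩
    rw [colSpan_mul_transpose]
    refine ae_affineLebesgue_Tw_eq hn hX hR hμ ⟨_, (mem_colSpan_iff _ _).2 ⟨z₀, rfl⟩, hz₀⟩ ?_
    intro v hv
    obtain ⟨z, rfl⟩ := (mem_colSpan_iff _ _).1 hv
    exact sub_eq_zero.1 (h z)
  · refine exists_sub_ne_zero_of_projPerp (r := r) hn hq hX hR hw ⟨_, hz₀⟩ (fun x => ?_) C
    have heq : colSpan A = (nullMeansLin X R r)ᗮ := by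
      refine Submodule.eq_of_le_of_finrank_le (colSpan_le_orthogonal_of_mem_closure hA) ?_
      have h1 := Submodule.finrank_add_finrank_orthogonal (nullMeansLin X R r)
      rw [finrank_euclideanSpace_fin] at h1
      rw [← colSpan_mul_transpose, finrank_colSpan]
      omega
    have hx : WithLp.toLp 2 (projPerp (nullMeansLin X R r) *ᵥ x) ∈ colSpan A := by
      rw [heq, toLp_projPerp_mulVec]
      exact Submodule.starProjection_apply_mem _ _
    obtain ⟨z, hz⟩ := (mem_colSpan_iff _ _).1 hx
    exact ⟨z, (congrArg WithLp.ofLp hz).symm⟩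

/-! ### Attaining a prescribed size -/

theorem exists_size_le (hn : 0 < n) (hX : X.rank = k) (hkn : k < n)
    (hR : R.rank = q) (hw : AssumptionAW n w) (hNI : NonIncl X R r) {ε : ℝ≥0∞} (hε : 0 < ε)
    (C₁ : ℝ) : ∃ C, C₁ ≤ C ∧
      size (nullMeans X R r) (covModel n Fall) {y | C ≤ Tw X R r w y} ≤ ε := by
  have h := eventually_rejProb_le (statNum_analytic hn w) (statDen_analytic hn w) (Tw_eq_div w)
    (isCompact_closure_normFactor (nullMeansLin_ne_top hkn))
    (fun A hA => exists_statDen_ne_zero hn hX hkn hw hNI hA) hε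
  obtain ⟨C, hC, hC₁⟩ := (h.and (eventually_ge_atTop C₁)).exists
  refine ⟨C, hC₁, ?_⟩
  rw [size_eq_iSup_rejProb hn hX hkn hR]
  exact iSup₂_le fun A hA => hC A (subset_closure hA)

theorem continuousOn_size (hn : 0 < n) (hq : 1 ≤ q) (hX : X.rank = k) (hkn : k < n)
    (hR : R.rank = q) (hw : AssumptionAW n w) (hNI : NonIncl X R r) :
    ContinuousOn (fun C : ℝ => size (nullMeans X R r) (covModel n Fall) {y | C ≤ Tw X R r w y})
      {C | Cstar (nullMeans X R r) (nullMeansLin X R r) (covModel n Fall) (Tw X R r w) < C} := by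
  simp only [size_eq_iSup_rejProb hn hX hkn hR]
  exact continuousOn_iSup_rejProb (statNum_analytic hn w) (statDen_analytic hn w) (Tw_eq_div w)
    (isCompact_closure_normFactor (nullMeansLin_ne_top hkn))
    (fun A hA => exists_statDen_ne_zero hn hX hkn hw hNI hA)
    (fun C hC A hA => exists_sub_ne_zero_of_Cstar_lt hn hq hX hkn hR hw hNI hC hA)

theorem one_le_size_zero (hn : 0 < n) (hX : X.rank = k) (hkn : k < n) (hR : R.rank = q)
    (hw : AssumptionAW n w) :
    1 ≤ size (nullMeans X R r) (covModel n Fall) {y | 0 ≤ Tw X R r w y} := by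
  rw [size_eq_iSup_rejProb hn hX hkn hR]
  obtain ⟨f, hf⟩ := Fall_nonempty
  refine le_iSup₂_of_le _ ⟨_, ⟨f, hf, rfl⟩, rfl⟩ ?_
  have h : {z : EuclideanSpace ℝ (Fin n) | 0 ≤ Tw X R 0 w (WithLp.toLp 2
      (normFactor (nullMeansLin X R r) (spectralCov n f) *ᵥ z.ofLp))} = Set.univ :=
    Set.eq_univ_of_forall fun z => Tw_nonneg hn hw 0 _
  rw [rejProb, h, measure_univ]

/-- Continuity may fail at C* for singular limits, but each actual Σ(f) has a factor with full
range, so its own rejection probability is continuous at C*. Letting C decrease to C* bounds it by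
α*; monotonicity gives the other inequality. -/
theorem size_Cstar_eq_alphaStar (hn : 0 < n) (hq : 1 ≤ q) (hX : X.rank = k) (hkn : k < n)
    (hR : R.rank = q) (hw : AssumptionAW n w) (hNI : NonIncl X R r) {c : ℝ}
    (hc : Cstar (nullMeans X R r) (nullMeansLin X R r) (covModel n Fall) (Tw X R r w) = c) :
    size (nullMeans X R r) (covModel n Fall) {y | c ≤ Tw X R r w y} =
      alphaStar (nullMeans X R r) (nullMeansLin X R r) (covModel n Fall) (Tw X R r w) := by
  have hmem : ∀ C : ℝ, c < C → size (nullMeans X R r) (covModel n Fall) {y | C ≤ Tw X R r w y} ≤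
      alphaStar (nullMeans X R r) (nullMeansLin X R r) (covModel n Fall) (Tw X R r w) := by
    intro C hC
    unfold alphaStar
    refine le_iSup₂_of_le C ?_ le_rfl
    rw [Set.mem_ofPred_eq, hc]
    exact EReal.coe_lt_coe_iff.2 hC
  refine le_antisymm ?_ (iSup₂_le fun C hC => ?_)
  · rw [size_eq_iSup_rejProb hn hX hkn hR]
    refine iSup₂_le fun A hA => ?_
    have h1 := exists_statDen_ne_zero hn hX hkn hw hNI (subset_closure hA)
    have h2 : ∃ z : Fin n → ℝ, statNum X R w (WithLp.toLp 2 (A *ᵥ z)) -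
        c * statDen X R w (WithLp.toLp 2 (A *ᵥ z)) ≠ 0 := by
      obtain ⟨_, ⟨f, hf, rfl⟩, rfl⟩ := hA
      obtain ⟨z, hz⟩ := h1
      exact exists_sub_ne_zero_of_projPerp hn hq hX hR hw ⟨_, hz⟩
        (exists_normFactor_mulVec_eq (nullMeansLin_ne_top hkn) hf) c
    have h3 : ContinuousAt (fun C => rejProb (Tw X R 0 w) A C) c :=
      ContinuousAt.comp (x := c) (f := fun C : ℝ => (A, C))
        (g := fun p : Matrix (Fin n) (Fin n) ℝ × ℝ => rejProb (Tw X R 0 w) p.1 p.2)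
        (continuousAt_rejProb (statNum_analytic hn w) (statDen_analytic hn w) (Tw_eq_div w) h1 h2)
        (by fun_prop)
    refine le_of_tendsto (h3.mono_left nhdsWithin_le_nhds : Tendsto _ (𝓝[>] c) _) ?_
    filter_upwards [self_mem_nhdsWithin] with C hC
    refine le_trans ?_ (hmem C hC)
    rw [size_eq_iSup_rejProb hn hX hkn hR]
    exact le_iSup₂ (f := fun A (_ : A ∈ normFactor (nullMeansLin X R r) '' covModel n Fall) =>
      rejProb (Tw X R 0 w) A C) A hA
  · rw [Set.mem_ofPred_eq, hc] at hC
    exact size_antitone _ _ _ (EReal.coe_lt_coe_iff.1 hC).le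

theorem exists_size_eq (hn : 0 < n) (hq : 1 ≤ q) (hX : X.rank = k) (hkn : k < n)
    (hR : R.rank = q) (hw : AssumptionAW n w) (hNI : NonIncl X R r) {a : ℝ≥0∞} (ha : 0 < a)
    (ha1 : a < 1)
    (hle : a ≤ alphaStar (nullMeans X R r) (nullMeansLin X R r) (covModel n Fall) (Tw X R r w)) :
    ∃ C : ℝ, size (nullMeans X R r) (covModel n Fall) {y | C ≤ Tw X R r w y} = a := by
  rcases hle.lt_or_eq with hlt | heq
  · unfold alphaStar at hlt
    simp only [lt_iSup_iff] at hlt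
    obtain ⟨C₁, hC₁, h₁⟩ := hlt
    -- The second threshold is taken above `C₁`, so the whole interval between them stays in (C*,
    -- ∞), where the size is continuous.
    obtain ⟨C₂, hC, h₂⟩ := exists_size_le hn hX hkn hR hw hNI ha C₁
    have hcont := (continuousOn_size hn hq hX hkn hR hw hNI).mono
      (fun C (h : C ∈ Set.Icc C₁ C₂) => lt_of_lt_of_le hC₁ (EReal.coe_le_coe_iff.2 h.1))
    obtain ⟨C, -, h⟩ := intermediate_value_Icc' hC hcont ⟨h₂, h₁.le⟩
    exact ⟨C, h⟩
  · induction hc : Cstar (nullMeans X R r) (nullMeansLin X R r) (covModel n Fall) (Tw X R r w) with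
    -- Here the threshold 0 is admissible, and since `T_w` is nonnegative it has size at least 1; so
    -- α* ≥ 1, which contradicts a < 1.
    | bot =>
      refine absurd ?_ ha1.not_ge
      rw [heq]
      refine (one_le_size_zero (r := r) hn hX hkn hR hw).trans ?_
      unfold alphaStar
      refine le_iSup₂_of_le (0 : ℝ) ?_ le_rfl
      rw [Set.mem_ofPred_eq, hc]
      exact EReal.bot_lt_coe 0
    | coe c => exact ⟨c, by rw [size_Cstar_eq_alphaStar hn hq hX hkn hR hw hNI hc, heq]⟩
    -- No threshold exceeds C*, so α* is a supremum over the empty set, that is 0.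
    | top =>
      refine absurd heq (ne_of_gt ?_)
      unfold alphaStar
      rw [hc]
      simpa using ha

/-- When `𝖡` is the subspace span(X), non-inclusion says that adjoining the columns of E strictly
enlarges span(X), hence raises the rank above k. -/
theorem nonIncl_iff_rank (hX : X.rank = k)
    (hB : setB X R = (colSpan X : Set (EuclideanSpace ℝ (Fin n)))) :
    NonIncl X R r ↔ ∀ γ ∈ Set.Icc (0 : ℝ) Real.pi,
      k < (fromCols X (Emat n (rho γ (nullMeansLin X R r)) γ)).rank := by
  unfold NonIncl
  rw [hB]
  refine forall₂_congr fun γ _ => ?_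
  set E := Emat n (rho γ (nullMeansLin X R r)) γ
  have hsup : colSpan (fromCols X E) = colSpan X ⊔ colSpan E := by
    rw [colSpan, colSpan, colSpan, ← Submodule.span_union]
    congr 1
    ext x
    simp [Sum.exists]
  rw [SetLike.coe_subset_coe, ← finrank_colSpan, hsup]
  constructor
  · intro h
    have h1 := Submodule.finrank_lt_finrank_of_lt (left_lt_sup.2 h)
    rwa [finrank_colSpan X, hX] at h1
  · intro h hle
    rw [sup_eq_left.2 hle, finrank_colSpan, hX] at h
    exact lt_irrefl _ h

end Concrete

end HAR

theorem mainTheorem1 {n k q : ℕ} (hk : 1 ≤ k) (hkn : k < n) (hq : 1 ≤ q)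
    (X : Matrix (Fin n) (Fin k) ℝ) (hX : X.rank = k)
    (R : Matrix (Fin q) (Fin k) ℝ) (hR : R.rank = q) (r : Fin q → ℝ)
    (w : ℤ → ℝ) (hw : HAR.AssumptionAW n w) (hRX : HAR.AssumptionRX X R) :
    -- size control is possible
    (HAR.NonIncl X R r → ∀ α : ℝ, 0 < α → α < 1 → ∃ C : ℝ,
      HAR.size (HAR.nullMeans X R r) (HAR.covModel n HAR.Fall) {y | C ≤ HAR.Tw X R r w y}
        ≤ ENNReal.ofReal α) ∧
    -- the rank form of the condition
    (HAR.setB X R = (HAR.colSpan X : Set (EuclideanSpace ℝ (Fin n))) →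
      (HAR.NonIncl X R r ↔ ∀ γ ∈ Set.Icc (0 : ℝ) Real.pi,
        k < (Matrix.fromCols X
          (HAR.Emat n (HAR.rho γ (HAR.nullMeansLin X R r)) γ)).rank)) ∧
    -- exact size control
    (HAR.NonIncl X R r → ∀ α : ℝ, 0 < α → α < 1 →
      ENNReal.ofReal α ≤ HAR.alphaStar (HAR.nullMeans X R r) (HAR.nullMeansLin X R r)
        (HAR.covModel n HAR.Fall) (HAR.Tw X R r w) →
      ∃ C : ℝ,
        HAR.size (HAR.nullMeans X R r) (HAR.covModel n HAR.Fall) {y | C ≤ HAR.Tw X R r w y}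
          = ENNReal.ofReal α) := by

  have hn : 0 < n := by omega
  refine ⟨fun hNI α hα _ => ?_, HAR.nonIncl_iff_rank hX, fun hNI α hα hα1 hle => ?_⟩
  · obtain ⟨C, -, hC⟩ := HAR.exists_size_le hn hX hkn hR hw hNI (ENNReal.ofReal_pos.2 hα) 0
    exact ⟨C, hC⟩
  · exact HAR.exists_size_eq hn hq hX hkn hR hw hNI (ENNReal.ofReal_pos.2 hα)
      (by rwa [← ENNReal.ofReal_one, ENNReal.ofReal_lt_ofReal_iff one_pos]) hle
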